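/- **Setting.** For $n\ge 2$ let $\mathcal M'_{0,n}$ be the moduli space of compact Riemann surfaces of genus $0$ with $n$ distinct points $s_0,\dots,s_{n-1}$ and a nonzero tangent vector $v$ at $s_0$. Normalizing $s_0=\infty$, $v$ dual to $d(1/x)$ at $\infty$, and $s_1=0$, we have $\mathcal M'_{0,n}=\{(s_1,\dots,s_{n-1})\in\mathbb C^{n-1}: s_1=0,\ s_i\neq s_j \text{ for } i\ne j\}$, and the universal family is $\mathcal M'_{0,n}\times\mathbb P^1(\mathbb C)$. Put $S^*=\{s_1,\dots,s_{n-1}\}$. In this normalization the Green function is $G(x,y)=\frac1{2\pi\sqrt{-1}}\log|x-y|^2$, and the twistor propagator is $\mathsf D^{\mathbb C}G=(w\partial-z\bar\partial)G+(z\,dw-w\,dz)G$, $(z,w)\in\mathbb C^2$. A *decorated graph* is a finite connected graph, with at least one edge, whose vertices are of valency $1$ (external) or $\ge 3$ (internal), with external vertices decorated by elements of $S^*$ and with an orientation $E_1\wedge\dots\wedge E_e$ of its set of edges. It is *uni-trivalent* if all internal vertices have valency $3$. Its defect is $2|E|-3|V^{\rm int}|-|V^{\rm ext}|$ and its number of loops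 is its first Betti number. Let $\mathcal{CD}^{\vee,d}$ be the complex vector space generated by decorated graphs of defect $d$ up to isomorphism, where reversing the orientation changes the sign, and where a graph is set to zero if it has a self-loop, or is a single edge with equal decorations, or has an internal vertex adjacent to two external vertices with equal decorations, or has two edges between the same two vertices. Let $\partial_\Delta\Gamma=\sum_E\Gamma/E$ (sum over internal edges, oriented by $\mathrm{Or}_\Gamma=E\wedge\mathrm{Or}_{\Gamma/E}$), let $\mathcal{CD}^d$ be the dual of $\mathcal{CD}^{\vee,d}$ (completed with respect to the number of edges), and let $H_0^{\partial_\Delta}=\mathrm{Coker}(\partial_\Delta^\vee:\mathcal{CD}^1\to\mathcal{CD}^0)$. Every graph $\Gamma$ of defect $0$ gives the class $[\Gamma^\vee]$ of the functional $\langle\Gamma,-\rangle$, where $\langle\Gamma,\Gamma'\rangle=\pm|\mathrm{Aut}(\Gamma)|$ if $\Gamma'=\pm\Gamma$ and $0$ otherwise (automorphisms are permutations of the half-edges that preserve edges, vertices and decorations). For a decorated graph $\Gamma$ let $Z_\Gamma$ be the form on $\mathcal M'_{0,n}\times\mathbb C^2$ obtained by integrating $\omega_{E_1}\wedge\dots\wedge\omega_{E_e}$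 over the fibres of the space of configurations of the internal vertices (distinct points of $\mathbb C\setminus S^*$), $\omega_E$ being the pullback of $\mathsf D^{\mathbb C}G$ to the two ends of $E$; $Z_\Gamma=0$ if $\Gamma$ has a self-loop or is a single edge with equal decorations. Put $$\mathbf S^{\rm eff}=\mathbf S^{\rm eff}_{\rm tree}+\hbar\,\mathbf S^{\rm eff}_{\text{1-loop}},\qquad \mathbf S^{\rm eff}_{\rm tree},\ \mathbf S^{\rm eff}_{\text{1-loop}}=\sum_{\Gamma}\frac1{|\mathrm{Aut}(\Gamma)|}Z_\Gamma\cdot[\Gamma^\vee],$$ the sums being over the isomorphism classes of uni-trivalent decorated graphs without self-loops that have $0$ loops, respectively $1$ loop. For a cyclic word $W$ of length $\geq 2$ in $S^*$ let $F(W)=\sum_T(T,W;\mathrm{Or}_T)$ be the sum over all planar uni-trivalent trees decorated by $W$, with their canonical orientation (number the edges along the oriented boundary, starting at an external edge). Then $\partial_\Delta F(W)=0$. The Hodge correlator class is $$\mathbf G=\sum_W\frac1{|\mathrm{Aut}(W)|}\sum_T Z_{(T,W;\mathrm{Or}_T)}\cdot W^\vee ,$$ and the pullback along $F$ is $F^*(\sigma)=\sum_W\frac1{|\mathrm{Aut}(W)|}\sigma(F(W))\,W^\vee$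 for $\sigma\in H_0^{\partial_\Delta}$. A prime denotes restriction to the twistor line $(z,w)=(1-u,u)$, and $|_{u=u_0}$ the restriction to the slice $\mathcal M'_{0,n}\times\{u_0\}$. **Proposition.** (1) For all $n\ge2$ and for $u_0=0$ and $u_0=1$: $$\mathbf S^{\rm eff}_{\text{1-loop}}{}'|_{u=u_0}=0,\qquad \mathbf S^{\rm eff}{}'|_{u=u_0}=\mathbf S^{\rm eff}_{\rm tree}{}'|_{u=u_0},\qquad F^*\bigl(\mathbf S^{\rm eff}_{\rm tree}{}'|_{u=u_0}\bigr)=\mathbf G'|_{u=u_0}.$$ (2) Let $n=4$. Sending $(z,v)$, where $z\in\mathbb P^1(\mathbb C)\setminus\{0,1,\infty\}$ and $v$ is a nonzero tangent vector at $z$, to the Riemann surface $\mathbb P^1(\mathbb C)$ with marked points $(s_0,s_1,s_2,s_3)=(z,0,1,\infty)$ and tangent vector $v$ identifies the space of these pairs with $\mathcal M'_{0,4}$; in the normalization above it is the map $(z,v)\mapsto(0,\tfrac{v}{1-z}+\tfrac vz,\tfrac vz)$. Write $X_0,X_1,X_\infty$ for the letters of $s_1,s_2,s_3$, let $X_\infty=-X_0-X_1$,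 and let a (possibly infinite) combination $\Phi$ of cyclic words act on the free algebra $\mathbb C\langle X_0,X_1\rangle$ (hence on the free Lie algebra, after completion) as the special derivation $X_s\mapsto[X_s,\partial \Phi/\partial X_s]$, where $\partial/\partial X_s$ is the cyclic derivative. Let $$\omega^{\rm KZ}=\frac1{2\pi\sqrt{-1}}\Bigl(\frac{dz}z\otimes X_0+\frac{dz}{z-1}\otimes X_1\Bigr),\qquad \overline\omega^{\rm KZ}=\frac{-1}{2\pi\sqrt{-1}}\Bigl(\frac{d\bar z}{\bar z}\otimes X_0+\frac{d\bar z}{\bar z-1}\otimes X_1\Bigr)$$ be the formal KZ connection and its complex conjugate, and let $\mathrm{ad}(X)$ be the derivation $Y\mapsto[Y,X]$. Then, as $1$-forms on the space of pairs $(z,v)$ with values in special derivations, and with the identifications of (1), $$\mathbf S^{\rm eff}{}'|_{u=1}=\mathbf S^{\rm eff}_{\rm tree}{}'|_{u=1}=\mathbf G'|_{u=1}=-(\mathrm{Id}\otimes\mathrm{ad})\,\omega^{\rm KZ},$$ $$\mathbf S^{\rm eff}{}'|_{u=0}=\mathbf S^{\rm eff}_{\rm tree}{}'|_{u=0}=\mathbf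 G'|_{u=0}=-(\mathrm{Id}\otimes\mathrm{ad})\,\overline\omega^{\rm KZ}.$$ -/

import Mathlib

namespace HodgeCorr

/-! ### Decorated graphs -/

/-- The half-edges of a graph whose edges are numbered `0, …, e - 1`. -/
abbrev HalfEdge (e : ℕ) : Type := Fin e × Bool

/-- The other half of the same edge. -/
def HalfEdge.flip {e : ℕ} (h : HalfEdge e) : HalfEdge e := (h.1, !h.2)

/-- A graph with `e` numbered edges: a partition of the half-edges into vertices, together with a
partial labelling of the half-edges by `S`. The numbering of the edges is the orientation
`E₀ ∧ ⋯ ∧ E_{e-1}`. -/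
@[ext] structure DGraph (S : Type*) (e : ℕ) where
  vtx : Setoid (HalfEdge e)
  dec : HalfEdge e → Option S

namespace DGraph

variable {S : Type*} {e : ℕ}

/-- The valency of the vertex that carries the half-edge `h`. -/
noncomputable def val (Γ : DGraph S e) (h : HalfEdge e) : ℕ := {h' | Γ.vtx h h'}.ncard

/-- Every vertex has valency `1` (external) or at least `3` (internal), and exactly the external
vertices are decorated by an element of `S`. -/
def IsDecorated (Γ : DGraph S e) : Prop :=
  (∀ h, Γ.val h = 1 ∨ 3 ≤ Γ.val h) ∧ ∀ h, (Γ.dec h).isSome ↔ Γ.val h = 1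

def IsConnected (Γ : DGraph S e) : Prop :=
  0 < e ∧ ∀ h h', Relation.EqvGen (fun a b => Γ.vtx a b ∨ b = a.flip) h h'

def IsUniTrivalent (Γ : DGraph S e) : Prop := ∀ h, Γ.val h = 1 ∨ Γ.val h = 3

/-- The internal vertices. -/
def IntVertex (Γ : DGraph S e) : Type :=
  {v : Quotient Γ.vtx // ∃ h, Γ.val h ≠ 1 ∧ Quotient.mk Γ.vtx h = v}

instance (Γ : DGraph S e) : Finite Γ.IntVertex := by
  unfold IntVertex; infer_instance

noncomputable def numInt (Γ : DGraph S e) : ℕ := Nat.card Γ.IntVertex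

noncomputable def numExt (Γ : DGraph S e) : ℕ := {h | Γ.val h = 1}.ncard

/-- The defect `2|E| - 3|V^int| - |V^ext|`. -/
noncomputable def defect (Γ : DGraph S e) : ℤ := 2 * e - 3 * Γ.numInt - Γ.numExt

/-- The first Betti number `|E| - |V| + 1` of a connected graph. -/
noncomputable def loops (Γ : DGraph S e) : ℤ := e - (Γ.numInt + Γ.numExt) + 1

/-- There is an edge that connects a vertex with itself. -/
def HasSelfLoop (Γ : DGraph S e) : Prop := ∃ i, Γ.vtx (i, false) (i, true)

/-- The graph is a single edge whose two ends carry the same label. -/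
def IsConstEdge (Γ : DGraph S e) : Prop :=
  e = 1 ∧ ∃ a : S, ∀ h, Γ.dec h = some a

/-- Two external vertices with the same label are attached to one internal vertex. -/
def HasConstFork (Γ : DGraph S e) : Prop :=
  ∃ h h' : HalfEdge e, h ≠ h' ∧ Γ.vtx h h' ∧ ∃ a : S, Γ.dec h.flip = some a ∧ Γ.dec h'.flip = some a

/-- Two different edges connect the same two vertices. -/
def HasMultiEdge (Γ : DGraph S e) : Prop :=
  ∃ h h' : HalfEdge e, h.1 ≠ h'.1 ∧ Γ.vtx h h' ∧ Γ.vtx h.flip h'.flip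

/-- The graphs that are set to zero. -/
def IsNull (Γ : DGraph S e) : Prop :=
  Γ.HasSelfLoop ∨ Γ.IsConstEdge ∨ Γ.HasConstFork ∨ Γ.HasMultiEdge

/-- Connected decorated uni-trivalent graphs without self-loops. -/
def IsFeynman (Γ : DGraph S e) : Prop :=
  Γ.IsDecorated ∧ Γ.IsUniTrivalent ∧ Γ.IsConnected ∧ ¬ Γ.HasSelfLoop

/-- Generators of defect `d` of the graph complex that are not set to zero. -/
def IsGen (d : ℤ) (Γ : DGraph S e) : Prop :=
  Γ.IsDecorated ∧ Γ.IsConnected ∧ Γ.defect = d ∧ ¬ Γ.IsNull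

/-! ### Isomorphisms -/

/-- Permutations of the half-edges that preserve the edges: a permutation of the edges together with
a permutation of the two halves of each of them. -/
abbrev Relabel (e : ℕ) : Type := Equiv.Perm (Fin e) × (Fin e → Equiv.Perm Bool)

def Relabel.perm (p : Relabel e) : Equiv.Perm (HalfEdge e) := Equiv.prodShear p.1 p.2

/-- The effect on orientations. -/
def Relabel.sgn (p : Relabel e) : ℂ := ((Equiv.Perm.sign p.1 : ℤ) : ℂ)

def Relabel.comp (p q : Relabel e) : Relabel e := (p.1 * q.1, fun i => p.2 (q.1 i) * q.2 i)

def Relabel.inv (p : Relabel e) : Relabel e := (p.1⁻¹, fun i => (p.2 (p.1⁻¹ i))⁻¹)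

def relabel (p : Relabel e) (Γ : DGraph S e) : DGraph S e where
  vtx := Γ.vtx.comap p.perm
  dec := fun h => Γ.dec (p.perm h)

theorem relabel_vtx (p : Relabel e) (Γ : DGraph S e) (a b : HalfEdge e) :
    (Γ.relabel p).vtx a b ↔ Γ.vtx (p.perm a) (p.perm b) := Iff.rfl

theorem Relabel.comp_perm (p q : Relabel e) (h : HalfEdge e) :
    (p.comp q).perm h = p.perm (q.perm h) := by
  simp [Relabel.comp, Relabel.perm, Equiv.prodShear]

theorem Relabel.inv_comp (p : Relabel e) : p.inv.comp p = (1, fun _ => 1) := by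
  ext i <;> simp [Relabel.comp, Relabel.inv]

theorem Relabel.comp_inv (p : Relabel e) : p.comp p.inv = (1, fun _ => 1) := by
  ext i <;> simp [Relabel.comp, Relabel.inv]

theorem Relabel.one_perm (h : HalfEdge e) : Relabel.perm ((1, fun _ => 1) : Relabel e) h = h := by
  simp [Relabel.perm, Equiv.prodShear]

theorem relabel_one (Γ : DGraph S e) : Γ.relabel (1, fun _ => 1) = Γ := by
  ext h h'
  · rw [relabel_vtx, Relabel.one_perm, Relabel.one_perm]
  · simp [relabel, Relabel.one_perm]

theorem relabel_relabel (p q : Relabel e) (Γ : DGraph S e) :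
    (Γ.relabel p).relabel q = Γ.relabel (p.comp q) := by
  ext h h'
  · change Γ.vtx (p.perm (q.perm h)) (p.perm (q.perm h')) ↔ (Γ.relabel _).vtx h h'
    rw [relabel_vtx, Relabel.comp_perm, Relabel.comp_perm]
  · simp [relabel, Relabel.comp_perm]

theorem Relabel.perm_flip (p : Relabel e) (h : HalfEdge e) : p.perm h.flip = (p.perm h).flip := by
  rcases h with ⟨i, b⟩
  have : ∀ (σ : Equiv.Perm Bool) (b : Bool), σ (!b) = !(σ b) := by decide
  simp [Relabel.perm, Equiv.prodShear, HalfEdge.flip, this]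

variable (S e) in
/-- Isomorphism of decorated graphs (orientations are disregarded). -/
def isoSetoid : Setoid (DGraph S e) where
  r Γ Γ' := ∃ p : Relabel e, Γ.relabel p = Γ'
  iseqv :=
    ⟨fun Γ => ⟨_, Γ.relabel_one⟩,
     fun {Γ Γ'} ⟨p, hp⟩ => ⟨p.inv, by
       rw [← hp, relabel_relabel, Relabel.comp_inv, relabel_one]⟩,
     fun {Γ Γ' Γ''} ⟨p, hp⟩ ⟨q, hq⟩ => ⟨p.comp q, by rw [← relabel_relabel, hp, hq]⟩⟩

/-- The number of automorphisms of a decorated graph. -/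
noncomputable def autCard (Γ : DGraph S e) : ℕ := Nat.card {p : Relabel e // Γ.relabel p = Γ}

theorem val_relabel (p : Relabel e) (Γ : DGraph S e) (h : HalfEdge e) :
    (Γ.relabel p).val h = Γ.val (p.perm h) := by
  have : {h' | Γ.vtx (p.perm h) h'} = p.perm '' {h' | (Γ.relabel p).vtx h h'} := by
    ext x
    simp only [Set.mem_ofPred_eq, Set.mem_image, relabel_vtx]
    exact ⟨fun hx => ⟨p.perm.symm x, by simpa using hx, by simp⟩, by rintro ⟨y, hy, rfl⟩; exact hy⟩
  rw [val, val, this, Set.ncard_image_of_injective _ p.perm.injective]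

theorem numExt_relabel (p : Relabel e) (Γ : DGraph S e) : (Γ.relabel p).numExt = Γ.numExt := by
  have : {h | Γ.val h = 1} = p.perm '' {h | (Γ.relabel p).val h = 1} := by
    ext x
    simp only [Set.mem_ofPred_eq, Set.mem_image, val_relabel]
    exact ⟨fun hx => ⟨p.perm.symm x, by simpa using hx, by simp⟩, by rintro ⟨y, hy, rfl⟩; exact hy⟩
  rw [numExt, numExt, this, Set.ncard_image_of_injective _ p.perm.injective]

theorem numInt_relabel (p : Relabel e) (Γ : DGraph S e) : (Γ.relabel p).numInt = Γ.numInt := by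
  refine Nat.card_congr ((Quotient.congr p.perm fun a b => Iff.rfl).subtypeEquiv fun v => ?_)
  constructor
  · rintro ⟨h, h1, rfl⟩
    exact ⟨p.perm h, by rwa [val_relabel] at h1, rfl⟩
  · rintro ⟨h, h1, h2⟩
    refine ⟨p.perm.symm h, by rw [val_relabel]; simpa using h1, ?_⟩
    apply (Quotient.congr p.perm fun a b => Iff.rfl).injective
    rw [← h2]
    show Quotient.mk _ (p.perm (p.perm.symm h)) = _
    simp

theorem IsGen.relabel {d : ℤ} {Γ : DGraph S e} (hΓ : Γ.IsGen d) (p : Relabel e) :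
    (Γ.relabel p).IsGen d := by
  obtain ⟨⟨h1, h2⟩, ⟨h3, h4⟩, h5, h6⟩ := hΓ
  refine ⟨⟨fun h => ?_, fun h => ?_⟩, ⟨h3, fun a b => ?_⟩, ?_, fun hN => h6 ?_⟩
  · rw [val_relabel]; exact h1 _
  · rw [val_relabel]; exact h2 _
  · have key : ∀ x y, Relation.EqvGen (fun a b => Γ.vtx a b ∨ b = a.flip) x y →
        Relation.EqvGen (fun a b => (Γ.relabel p).vtx a b ∨ b = a.flip)
          (p.perm.symm x) (p.perm.symm y) := by
      intro x y hxy
      induction hxy with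
      | rel x y h =>
        refine .rel _ _ ?_
        rcases h with h | h
        · left; simpa [relabel_vtx] using h
        · right; apply p.perm.injective; rw [Relabel.perm_flip]; simpa using h
      | refl x => exact .refl _
      | symm x y _ ih => exact .symm _ _ ih
      | trans x y z _ _ ih1 ih2 => exact .trans _ _ _ ih1 ih2
    simpa using key _ _ (h4 (p.perm a) (p.perm b))
  · rw [defect, numExt_relabel, numInt_relabel]; exact h5
  · rcases hN with ⟨i, hi⟩ | ⟨he, a, ha⟩ | ⟨h, h', hne, hv, a, ha, ha'⟩ | ⟨h, h', hne, hv, hv'⟩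
    · left
      have hi : Γ.vtx (p.perm (i, false)) (p.perm (i, true)) := hi
      have hf : p.perm (i, true) = (p.perm (i, false)).flip := by
        rw [← Relabel.perm_flip]; rfl
      rw [hf] at hi
      refine ⟨(p.perm (i, false)).1, ?_⟩
      rcases hp : p.perm (i, false) with ⟨j, b⟩
      rw [hp] at hi
      cases b
      · exact hi
      · exact Γ.vtx.symm' hi
    · right; left
      refine ⟨he, a, fun h => ?_⟩
      simpa [DGraph.relabel] using ha (p.perm.symm h)
    · right; right; left
      refine ⟨p.perm h, p.perm h', fun hh => hne (p.perm.injective hh), hv, a, ?_, ?_⟩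
      · rw [← Relabel.perm_flip]; exact ha
      · rw [← Relabel.perm_flip]; exact ha'
    · right; right; right
      refine ⟨p.perm h, p.perm h', fun hh => hne (p.1.injective hh), hv, ?_⟩
      rw [← Relabel.perm_flip, ← Relabel.perm_flip]; exact hv'

theorem isGen_relabel_iff {d : ℤ} {Γ : DGraph S e} (p : Relabel e) :
    (Γ.relabel p).IsGen d ↔ Γ.IsGen d := by
  refine ⟨fun h => ?_, fun h => h.relabel p⟩
  have := h.relabel p.inv
  rwa [relabel_relabel, Relabel.comp_inv, relabel_one] at this

instance [Finite S] : Finite (DGraph S e) := by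
  refine Finite.of_injective
    (fun Γ : DGraph S e => ((fun a b => Γ.vtx a b : HalfEdge e → HalfEdge e → Prop), Γ.dec)) ?_
  intro Γ Γ' h
  simp only [Prod.mk.injEq] at h
  ext a b
  · exact iff_of_eq (congrFun (congrFun h.1 a) b)
  · rw [h.2]


/-! ### The graph complex -/

open Classical in
/-- Contraction of the edge `c`; the other edges keep their order. -/
noncomputable def contract (Γ : DGraph S (e + 1)) (c : Fin (e + 1)) : DGraph S e where
  vtx := (Setoid.ker fun h : HalfEdge (e + 1) =>
    if Γ.vtx h (c, true) then Quotient.mk Γ.vtx (c, false) else Quotient.mk Γ.vtx h).comap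
      fun h : HalfEdge e => (c.succAbove h.1, h.2)
  dec := fun h => Γ.dec (c.succAbove h.1, h.2)

/-- Both ends of the edge are internal vertices. -/
def IsInternalEdge (Γ : DGraph S e) (c : Fin e) : Prop := ∀ b, Γ.val (c, b) ≠ 1

end DGraph

open DGraph

variable (S : Type*)

/-- The dual of the space of oriented connected decorated graphs with `e` edges and defect `d`:
functions on graphs that change sign with the orientation, that depend only on the isomorphism class,
and that vanish on the graphs which are set to zero. -/
def CD (d : ℤ) (e : ℕ) : Submodule ℂ (DGraph S e → ℂ) where
  carrier := {f | (∀ Γ, ¬ Γ.IsGen d → f Γ = 0) ∧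
    ∀ (p : Relabel e) (Γ : DGraph S e), f (Γ.relabel p) = p.sgn * f Γ}
  add_mem' := by
    rintro f g ⟨hf, hf'⟩ ⟨hg, hg'⟩
    exact ⟨fun Γ h => by simp [hf Γ h, hg Γ h], fun p Γ => by simp [hf' p Γ, hg' p Γ, mul_add]⟩
  zero_mem' := ⟨fun _ _ => rfl, fun p Γ => by simp⟩
  smul_mem' := by
    rintro a f ⟨hf, hf'⟩
    exact ⟨fun Γ h => by simp [hf Γ h], fun p Γ => by simp [hf' p Γ, mul_left_comm]⟩

open Classical in
/-- The image of the map `CD 1 → CD 0` dual to the edge contraction differential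
`∂ Γ = ∑_c (-1) ^ c Γ / c`, the sum being over the internal edges. -/
noncomputable def IHX : (e : ℕ) → Submodule ℂ (CD S 0 e)
  | 0 => ⊥
  | e + 1 =>
    { carrier := {f | ∃ g ∈ CD S 1 e, ∀ Γ : DGraph S (e + 1), Γ.IsFeynman →
        f.1 Γ = ∑ c, if Γ.IsInternalEdge c then (-1) ^ (c : ℕ) * g (Γ.contract c) else 0}
      add_mem' := by
        rintro f f' ⟨g, hg, h⟩ ⟨g', hg', h'⟩
        refine ⟨g + g', add_mem hg hg', fun Γ hΓ => ?_⟩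
        simp only [Submodule.coe_add, Pi.add_apply, h Γ hΓ, h' Γ hΓ, ← Finset.sum_add_distrib]
        exact Finset.sum_congr rfl fun c _ => by split_ifs <;> ring
      zero_mem' := ⟨0, zero_mem _, fun Γ _ => by simp⟩
      smul_mem' := by
        rintro a f ⟨g, hg, h⟩
        refine ⟨a • g, (CD S 1 e).smul_mem a hg, fun Γ hΓ => ?_⟩
        simp only [Submodule.coe_smul, Pi.smul_apply, h Γ hΓ, smul_eq_mul, Finset.mul_sum]
        exact Finset.sum_congr rfl fun c _ => by split_ifs <;> ring }

/-- The zeroth homology with respect to edge contraction, graphs with `e` edges. -/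
abbrev H0 (e : ℕ) : Type _ := CD S 0 e ⧸ IHX S e

/-- The zeroth homology, completed with respect to the number of edges. -/
abbrev H0hat : Type _ := ∀ e, H0 S e

variable {S} {e : ℕ}

open Classical in
/-- The functional `⟨Γ, -⟩`, whose value at `Γ'` is `± |Aut Γ|` if `Γ'` is isomorphic to `Γ` and
`0` otherwise (and `0` if `Γ` has an automorphism that reverses the orientation). -/
noncomputable def dualGraph (Γ : DGraph S e) : CD S 0 e :=
  ⟨fun Γ' => if Γ'.IsGen 0 then ∑ p : Relabel e, if Γ.relabel p = Γ' then p.sgn else 0 else 0, by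
    refine ⟨fun Γ' h => by simp [h], fun q Γ' => ?_⟩
    simp only [isGen_relabel_iff]
    split_ifs with hg
    · rw [Finset.mul_sum]
      symm
      refine Finset.sum_bij' (fun p _ => Relabel.comp p q) (fun p _ => Relabel.comp p q.inv)
        (by simp) (by simp) (fun p _ => ?_) (fun p _ => ?_) (fun p _ => ?_)
      · ext i <;> simp [Relabel.comp, Relabel.inv]
      · ext i <;> simp [Relabel.comp, Relabel.inv]
      · have h1 : (Γ.relabel (p.comp q) = Γ'.relabel q) ↔ Γ.relabel p = Γ' := by
          rw [← relabel_relabel]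
          refine ⟨fun h => ?_, fun h => by rw [h]⟩
          have := congrArg (fun G => DGraph.relabel q.inv G) h
          have h2 : (p.comp q).comp q.inv = p := by
            ext i <;> simp [Relabel.comp, Relabel.inv]
          simpa only [relabel_relabel, Relabel.comp_inv, relabel_one, h2] using this
        rw [h1]
        split_ifs
        · simp [Relabel.sgn, Relabel.comp, mul_comm]
        · simp
    · simp⟩

/-! ### Planar trees -/

/-- The edges of a planar binary tree in preorder. An entry `(q, x)` stands for an edge whose upper
end is the vertex `q`; the lower end of the edge with number `i` is the vertex `i + 1`, and `x` is
the number of the leaf at the lower end, if there is one. The topmost edge has upper end `p` and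
number `k`, and the leaves are numbered from `j` on. -/
def treeEdges : BinaryTree Unit → ℕ → ℕ → ℕ → List (ℕ × Option ℕ)
  | .nil, p, _, j => [(p, some j)]
  | .node _ l r, p, k, j =>
    (p, none) :: (treeEdges l (k + 1) (k + 1) j ++
      treeEdges r (k + 1) (k + 2 + 2 * l.numNodes) (j + l.numNodes + 1))

/-- The entry with number `i`. -/
def edgeAt (L : List (ℕ × Option ℕ)) (i : ℕ) : ℕ × Option ℕ := L.getD i (0, none)

/-- The graph with edges `L`; the end with number `0` of the first edge is decorated by the first
letter of `w`, and the end with the leaf number `j` by the letter `j` of `w`. -/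
def ofEdges (e : ℕ) (w : List S) (L : List (ℕ × Option ℕ)) : DGraph S e where
  vtx := Setoid.ker fun h : HalfEdge e => if h.2 then (h.1 : ℕ) + 1 else (edgeAt L h.1).1
  dec := fun h =>
    if h.2 then (edgeAt L h.1).2.bind (w[·]?) else if (h.1 : ℕ) = 0 then w[0]? else none

/-- The planar uni-trivalent tree with root decorated by the first letter of `w` and leaves decorated
by the other ones, with its canonical orientation. -/
def treeGraph (e : ℕ) (w : List S) (t : BinaryTree Unit) : DGraph S e :=
  ofEdges e w (treeEdges t 0 0 1)

theorem length_treeEdges (t : BinaryTree Unit) (p k j : ℕ) :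
    (treeEdges t p k j).length = 2 * t.numNodes + 1 := by
  induction t generalizing p k j with
  | nil => simp [treeEdges, BinaryTree.numNodes]
  | node x l r ihl ihr => simp [treeEdges, BinaryTree.numNodes, ihl, ihr]; ring

/-- The renumbering of the vertices under contraction of the edge `c` with upper end `P`. -/
def rho (c P q : ℕ) : ℕ := if q ≤ c then q else if q = c + 1 then P else q - 1

/-- Contraction of the edge with number `K` and position `c` in a list of edges. -/
def contractEdges (K c : ℕ) (L : List (ℕ × Option ℕ)) : List (ℕ × Option ℕ) :=
  (L.eraseIdx c).map (Prod.map (rho K (edgeAt L c).1) id)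

theorem contract_ofEdges (w : List S) (L : List (ℕ × Option ℕ)) (hL : L.length = e + 1)
    (c : Fin (e + 1)) (hc : 0 < (c : ℕ)) (hP : (edgeAt L c).1 ≤ c) :
    (ofEdges (e + 1) w L).contract c = ofEdges e w (contractEdges c c L) := by
  have hget : ∀ j : Fin e, edgeAt (contractEdges c c L) j =
      Prod.map (rho c (edgeAt L c).1) id (edgeAt L (c.succAbove j : Fin (e + 1))) := by
    intro j
    have h1 : (j : ℕ) < (contractEdges c c L).length := by
      simp only [contractEdges, List.length_map]
      rw [List.length_eraseIdx_of_lt (by rw [hL]; exact c.isLt), hL]; simp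
    have h2 : ∀ i, (hi : i < L.length) → edgeAt L i = L[i] := fun i hi => List.getD_eq_getElem _ _ hi
    rw [h2 (c.succAbove j : Fin (e + 1)) (by rw [hL]; exact Fin.isLt _)]
    rw [show edgeAt (contractEdges c c L) j = (contractEdges c c L)[(j : ℕ)] from
      List.getD_eq_getElem _ _ h1]
    simp only [contractEdges, List.getElem_map, List.getElem_eraseIdx]
    by_cases hj : (j : ℕ) < c
    · have : c.succAbove j = j.castSucc := Fin.succAbove_of_castSucc_lt _ _ hj
      simp [hj, this]
    · have : c.succAbove j = j.succ := Fin.succAbove_of_le_castSucc _ _ (by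
        rw [Fin.le_def]; simpa using hj)
      simp [hj, this]
  have hS : ∀ j : Fin e, ((c.succAbove j : Fin (e + 1)) : ℕ) = if (j : ℕ) < c then (j : ℕ) else j + 1 := by
    intro j
    split_ifs with hj
    · rw [Fin.succAbove_of_castSucc_lt _ _ hj]; simp
    · rw [Fin.succAbove_of_le_castSucc _ _ (by rw [Fin.le_def]; simpa using hj)]; simp
  set P := (edgeAt L c).1 with hPdef
  set N : HalfEdge (e + 1) → ℕ := fun h => if h.2 then (h.1 : ℕ) + 1 else (edgeAt L h.1).1
    with hN
  have hname : ∀ h : HalfEdge e,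
      (if h.2 then (h.1 : ℕ) + 1 else (edgeAt (contractEdges c c L) h.1).1) =
        rho c P (N (c.succAbove h.1, h.2)) := by
    rintro ⟨j, b⟩
    cases b
    · simp [hN, hget j]
    · simp only [hN, if_true, hS j, rho]
      split_ifs <;> omega
  have hrho : ∀ q q', rho c P q = rho c P q' ↔
      (if q = c + 1 then P else q) = (if q' = c + 1 then P else q') := by
    intro q q'
    simp only [rho]
    split_ifs <;> omega
  classical
  ext a b
  · change (if (ofEdges (e + 1) w L).vtx (c.succAbove a.1, a.2) (c, true) then
        Quotient.mk (ofEdges (e + 1) w L).vtx (c, false)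
      else Quotient.mk (ofEdges (e + 1) w L).vtx (c.succAbove a.1, a.2)) =
      (if (ofEdges (e + 1) w L).vtx (c.succAbove b.1, b.2) (c, true) then
        Quotient.mk (ofEdges (e + 1) w L).vtx (c, false)
      else Quotient.mk (ofEdges (e + 1) w L).vtx (c.succAbove b.1, b.2)) ↔
      (if a.2 then (a.1 : ℕ) + 1 else (edgeAt (contractEdges c c L) a.1).1) =
      (if b.2 then (b.1 : ℕ) + 1 else (edgeAt (contractEdges c c L) b.1).1)
    rw [hname, hname, hrho]
    have hv : ∀ x y, (ofEdges (e + 1) w L).vtx x y ↔ N x = N y := fun x y => Iff.rfl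
    have hq : ∀ x y, Quotient.mk (ofEdges (e + 1) w L).vtx x =
        Quotient.mk (ofEdges (e + 1) w L).vtx y ↔ N x = N y := fun x y => Quotient.eq
    have h1 : N (c, true) = c + 1 := by simp [hN]
    have h2 : N (c, false) = P := by simp [hN, hPdef]
    simp only [hv, h1]
    split_ifs <;> simp [*]
  · change (if a.2 then (edgeAt L (c.succAbove a.1 : Fin (e + 1))).2.bind (w[·]?)
      else if ((c.succAbove a.1 : Fin (e + 1)) : ℕ) = 0 then w[0]? else none) = some b ↔
      (if a.2 then (edgeAt (contractEdges c c L) a.1).2.bind (w[·]?)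
      else if (a.1 : ℕ) = 0 then w[0]? else none) = some b
    rw [hget]
    have : ((c.succAbove a.1 : Fin (e + 1)) : ℕ) = 0 ↔ (a.1 : ℕ) = 0 := by
      have := hS a.1
      split_ifs at this <;> constructor <;> intro h <;> omega
    simp [this]
theorem rho_map_id (t : BinaryTree Unit) (p k j c P : ℕ) (hp : p ≤ c) (hk : k + 2 * t.numNodes ≤ c) :
    (treeEdges t p k j).map (Prod.map (rho c P) id) = treeEdges t p k j := by
  induction t generalizing p k j with
  | nil => simp [treeEdges, rho, hp]
  | node x l r ihl ihr =>
    simp only [BinaryTree.numNodes] at hk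
    simp only [treeEdges, List.map_cons, List.map_append]
    rw [ihl _ _ _ (by omega) (by omega), ihr _ _ _ (by omega) (by omega)]
    simp [rho, hp]

theorem rho_map_shift (t : BinaryTree Unit) (p k j c P : ℕ) (hk : c ≤ k) :
    (treeEdges t p (k + 1) j).map (Prod.map (rho c P) id) = treeEdges t (rho c P p) k j := by
  induction t generalizing p k j with
  | nil => simp [treeEdges]
  | node x l r ihl ihr =>
    have h : rho c P (k + 1 + 1) = k + 1 := by
      simp only [rho]; split_ifs <;> omega
    simp only [treeEdges, List.map_cons, List.map_append]
    rw [ihl _ _ _ (by omega), show k + 1 + 2 + 2 * l.numNodes = k + 2 + 2 * l.numNodes + 1 by ring,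
      ihr _ _ _ (by omega), h]
    rfl

/-- Contraction of the internal edges of a planar tree. -/
def contractSum (h : List (ℕ × Option ℕ) → ℂ) (t : BinaryTree Unit) (p k j : ℕ) : ℂ :=
  ∑ c ∈ Finset.range (2 * t.numNodes + 1),
    if 0 < c ∧ (edgeAt (treeEdges t p k j) c).2 = none then
      (-1) ^ c * h (contractEdges (k + c) c (treeEdges t p k j)) else 0

/-- The list of edges of a planar tree with one vertex of valency four below its topmost edge. -/
def terEdges (a b c : BinaryTree Unit) (p k j : ℕ) : List (ℕ × Option ℕ) :=
  (p, none) :: (treeEdges a (k + 1) (k + 1) j ++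
    (treeEdges b (k + 1) (k + 2 + 2 * a.numNodes) (j + a.numNodes + 1) ++
      treeEdges c (k + 1) (k + 3 + 2 * a.numNodes + 2 * b.numNodes)
        (j + a.numNodes + b.numNodes + 2)))

def leftTerm (h : List (ℕ × Option ℕ) → ℂ) : (l r : BinaryTree Unit) → (p k j : ℕ) → ℂ
  | .nil, _, _, _, _ => 0
  | .node _ a b, r, p, k, j => h (terEdges a b r p k j)

def rightTerm (h : List (ℕ × Option ℕ) → ℂ) : (l r : BinaryTree Unit) → (p k j : ℕ) → ℂ
  | _, .nil, _, _, _ => 0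
  | l, .node _ b c, p, k, j => h (terEdges l b c p k j)

theorem edgeAt_cons_append_left (x : ℕ × Option ℕ) (A B : List (ℕ × Option ℕ)) (i : ℕ)
    (hi : i < A.length) : edgeAt (x :: (A ++ B)) (1 + i) = edgeAt A i := by
  rw [add_comm]
  simp [edgeAt, List.getElem?_append_left hi]

theorem edgeAt_cons_append_right (x : ℕ × Option ℕ) (A B : List (ℕ × Option ℕ)) (i : ℕ) :
    edgeAt (x :: (A ++ B)) (1 + A.length + i) = edgeAt B i := by
  rw [show 1 + A.length + i = A.length + i + 1 by ring]
  simp [edgeAt, List.getElem?_append_right]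

theorem eraseIdx_cons_append_left (x : ℕ × Option ℕ) (A B : List (ℕ × Option ℕ)) (i : ℕ)
    (hi : i < A.length) : (x :: (A ++ B)).eraseIdx (1 + i) = x :: (A.eraseIdx i ++ B) := by
  rw [add_comm, List.eraseIdx_cons_succ, List.eraseIdx_append_of_lt_length hi]

theorem eraseIdx_cons_append_right (x : ℕ × Option ℕ) (A B : List (ℕ × Option ℕ)) (i : ℕ) :
    (x :: (A ++ B)).eraseIdx (1 + A.length + i) = x :: (A ++ B.eraseIdx i) := by
  rw [show 1 + A.length + i = A.length + i + 1 by ring, List.eraseIdx_cons_succ,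
    List.eraseIdx_append_of_length_le (by omega)]
  simp

theorem contractSum_node (h : List (ℕ × Option ℕ) → ℂ) (x : Unit) (l r : BinaryTree Unit)
    (p k j : ℕ) (hp : p ≤ k) :
    contractSum h (.node x l r) p k j =
      rightTerm h l r p k j - leftTerm h l r p k j
      - contractSum (fun L => h ((p, none) :: (L ++
          treeEdges r (k + 1) (k + 1 + 2 * l.numNodes) (j + l.numNodes + 1)))) l (k + 1) (k + 1) j
      + contractSum (fun L => h ((p, none) :: (treeEdges l (k + 1) (k + 1) j ++ L))) r
          (k + 1) (k + 2 + 2 * l.numNodes) (j + l.numNodes + 1) := by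
  have hA := length_treeEdges l (k + 1) (k + 1) j
  set A := treeEdges l (k + 1) (k + 1) j with hAdef
  have hB := length_treeEdges r (k + 1) (k + 2 + 2 * l.numNodes) (j + l.numNodes + 1)
  set B := treeEdges r (k + 1) (k + 2 + 2 * l.numNodes) (j + l.numNodes + 1) with hBdef
  have hL : treeEdges (.node x l r) p k j = (p, none) :: (A ++ B) := rfl
  have hrange : 2 * (BinaryTree.node x l r).numNodes + 1 = 1 + A.length + B.length := by
    rw [hA, hB]; simp only [BinaryTree.numNodes]; ring
  have hleft : ∀ i < A.length, contractEdges (k + (1 + i)) (1 + i) ((p, none) :: (A ++ B)) =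
      (p, none) :: (contractEdges (k + 1 + i) i A ++
        treeEdges r (k + 1) (k + 1 + 2 * l.numNodes) (j + l.numNodes + 1)) := by
    intro i hi
    have h1 := rho_map_shift r (k + 1) (k + 1 + 2 * l.numNodes) (j + l.numNodes + 1) (k + 1 + i)
      (edgeAt A i).1 (by omega)
    have h2 : rho (k + 1 + i) (edgeAt A i).1 (k + 1) = k + 1 := by simp [rho]
    have h3 : rho (k + 1 + i) (edgeAt A i).1 p = p := by simp only [rho]; rw [if_pos]; omega
    rw [h2, show k + 1 + 2 * l.numNodes + 1 = k + 2 + 2 * l.numNodes by ring] at h1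
    rw [contractEdges, edgeAt_cons_append_left _ _ _ _ hi, eraseIdx_cons_append_left _ _ _ _ hi,
      List.map_cons, List.map_append, ← add_assoc, h1, contractEdges]
    simp [h3]
  have hright : ∀ i, contractEdges (k + (1 + A.length + i)) (1 + A.length + i)
      ((p, none) :: (A ++ B)) =
      (p, none) :: (A ++ contractEdges (k + 2 + 2 * l.numNodes + i) i B) := by
    intro i
    have h1 := rho_map_id l (k + 1) (k + 1) j (k + (1 + A.length + i)) (edgeAt B i).1 (by omega)
      (by omega)
    have h3 : rho (k + (1 + A.length + i)) (edgeAt B i).1 p = p := by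
      simp only [rho]; rw [if_pos]; omega
    rw [contractEdges, edgeAt_cons_append_right, eraseIdx_cons_append_right,
      List.map_cons, List.map_append, h1, contractEdges]
    simp only [Prod.map_apply, h3, id]
    rw [show k + (1 + A.length + i) = k + 2 + 2 * l.numNodes + i by omega]
  have hl0 : leftTerm h l r p k j = if (edgeAt A 0).2 = none then
      h ((p, none) :: (contractEdges (k + 1 + 0) 0 A ++
        treeEdges r (k + 1) (k + 1 + 2 * l.numNodes) (j + l.numNodes + 1))) else 0 := by
    cases l with
    | nil => simp [hAdef, leftTerm, treeEdges, edgeAt]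
    | node y a b =>
      have h2 : rho (k + 1) (k + 1) (k + 1 + 1) = k + 1 := by simp [rho]
      have e1 := rho_map_shift a (k + 1 + 1) (k + 1) j (k + 1) (k + 1) le_rfl
      have e2 := rho_map_shift b (k + 1 + 1) (k + 2 + 2 * a.numNodes) (j + a.numNodes + 1)
        (k + 1) (k + 1) (by omega)
      rw [h2] at e1 e2
      rw [show k + 2 + 2 * a.numNodes + 1 = k + 1 + 2 + 2 * a.numNodes by ring] at e2
      rw [hAdef, treeEdges]
      simp only [edgeAt, List.getD_cons_zero, if_true, leftTerm, terEdges, contractEdges,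
        List.eraseIdx_cons_zero, List.map_append, add_zero]
      rw [e1, e2, List.append_assoc]
      simp only [BinaryTree.numNodes]
      rw [show k + 1 + 2 * (a.numNodes + b.numNodes + 1) =
          k + 3 + 2 * a.numNodes + 2 * b.numNodes by ring,
        show j + (a.numNodes + b.numNodes + 1) + 1 = j + a.numNodes + b.numNodes + 2 by ring]
  have hr0 : rightTerm h l r p k j = if (edgeAt B 0).2 = none then
      h ((p, none) :: (A ++ contractEdges (k + 2 + 2 * l.numNodes + 0) 0 B)) else 0 := by
    cases r with
    | nil => simp [hBdef, rightTerm, treeEdges, edgeAt]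
    | node y b c =>
      have h2 : rho (k + 2 + 2 * l.numNodes) (k + 1) (k + 2 + 2 * l.numNodes + 1) = k + 1 := by
        simp [rho]
      have e1 := rho_map_shift b (k + 2 + 2 * l.numNodes + 1) (k + 2 + 2 * l.numNodes)
        (j + l.numNodes + 1) (k + 2 + 2 * l.numNodes) (k + 1) le_rfl
      have e2 := rho_map_shift c (k + 2 + 2 * l.numNodes + 1)
        (k + 3 + 2 * l.numNodes + 2 * b.numNodes) (j + l.numNodes + 1 + b.numNodes + 1)
        (k + 2 + 2 * l.numNodes) (k + 1) (by omega)
      rw [h2] at e1 e2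
      rw [show k + 3 + 2 * l.numNodes + 2 * b.numNodes + 1 =
        k + 2 + 2 * l.numNodes + 2 + 2 * b.numNodes by ring] at e2
      rw [hBdef, treeEdges]
      simp only [edgeAt, List.getD_cons_zero, if_true, rightTerm, terEdges, contractEdges,
        List.eraseIdx_cons_zero, List.map_append, add_zero]
      rw [e1, e2, show j + l.numNodes + 1 + b.numNodes + 1 = j + l.numNodes + b.numNodes + 2 by ring]
  rw [contractSum, hL, hrange, Finset.sum_range_add, Finset.sum_range_add]
  have s0 : ∀ f : ℕ → ℂ, (∑ c ∈ Finset.range 1, if 0 < c ∧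
      (edgeAt ((p, none) :: (A ++ B)) c).2 = none then f c else 0) = 0 := by simp
  rw [s0]
  have s1 : (∑ i ∈ Finset.range A.length, if 0 < 1 + i ∧
      (edgeAt ((p, none) :: (A ++ B)) (1 + i)).2 = none then
        (-1) ^ (1 + i) * h (contractEdges (k + (1 + i)) (1 + i) ((p, none) :: (A ++ B))) else 0) =
      - leftTerm h l r p k j - contractSum (fun L => h ((p, none) :: (L ++
          treeEdges r (k + 1) (k + 1 + 2 * l.numNodes) (j + l.numNodes + 1)))) l (k + 1) (k + 1) j := by
    rw [contractSum, ← hAdef, ← hA, hl0]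
    have hpos : A.length = (A.length - 1) + 1 := by omega
    rw [hpos, Finset.sum_range_succ', Finset.sum_range_succ']
    rw [edgeAt_cons_append_left _ _ _ 0 (by omega), hleft 0 (by omega)]
    rw [Finset.sum_congr rfl (g := fun i => - if 0 < i + 1 ∧ (edgeAt A (i + 1)).2 = none then
      (-1) ^ (i + 1) * h ((p, none) :: (contractEdges (k + 1 + (i + 1)) (i + 1) A ++
        treeEdges r (k + 1) (k + 1 + 2 * l.numNodes) (j + l.numNodes + 1))) else 0)]
    · rw [Finset.sum_neg_distrib]
      by_cases h0 : (edgeAt A 0).2 = none 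
      · simp [h0]; ring
      · simp [h0]
    · intro i hi
      rw [Finset.mem_range] at hi
      rw [edgeAt_cons_append_left _ _ _ _ (by omega), hleft _ (by omega)]
      by_cases h0 : (edgeAt A (i + 1)).2 = none <;> simp [h0, pow_add]
  have s2 : (∑ i ∈ Finset.range B.length, if 0 < 1 + A.length + i ∧
      (edgeAt ((p, none) :: (A ++ B)) (1 + A.length + i)).2 = none then
        (-1) ^ (1 + A.length + i) * h (contractEdges (k + (1 + A.length + i)) (1 + A.length + i)
          ((p, none) :: (A ++ B))) else 0) =
      rightTerm h l r p k j + contractSum (fun L => h ((p, none) :: (A ++ L))) r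
          (k + 1) (k + 2 + 2 * l.numNodes) (j + l.numNodes + 1) := by
    rw [contractSum, ← hBdef, ← hB, hr0]
    have hsgn : ∀ i, (-1 : ℂ) ^ (1 + A.length + i) = (-1) ^ i := by
      intro i
      rw [hA, show 1 + (2 * l.numNodes + 1) + i = 2 * (l.numNodes + 1) + i by ring, pow_add,
        pow_mul]
      simp
    have hpos : B.length = (B.length - 1) + 1 := by omega
    simp only [hright, edgeAt_cons_append_right, hsgn]
    rw [hpos, Finset.sum_range_succ', Finset.sum_range_succ']
    have : ∀ i, 0 < 1 + A.length + i := fun i => by omega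
    by_cases h0 : (edgeAt B 0).2 = none
    · simp [h0, this]; ring
    · simp [h0, this]
  rw [s1, s2]
  ring

theorem sum_trees_succ (n : ℕ) (F : BinaryTree Unit → ℂ) :
    ∑ t ∈ BinaryTree.treesOfNumNodesEq (n + 1), F t =
      ∑ ij ∈ Finset.HasAntidiagonal.antidiagonal n, ∑ l ∈ BinaryTree.treesOfNumNodesEq ij.1,
        ∑ r ∈ BinaryTree.treesOfNumNodesEq ij.2, F (.node () l r) := by
  rw [BinaryTree.treesOfNumNodesEq_succ, Finset.sum_biUnion]
  · refine Finset.sum_congr rfl fun ij _ => ?_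
    rw [Finset.sum_map, Finset.sum_product]
    rfl
  · intro x _ y _ hxy
    rw [Function.onFun, Finset.disjoint_left]
    intro t ht ht'
    rw [Finset.mem_map] at ht ht'
    simp only [Finset.mem_product, BinaryTree.mem_treesOfNumNodesEq] at ht ht'
    obtain ⟨⟨a, b⟩, ⟨h1, h2⟩, rfl⟩ := ht
    obtain ⟨⟨a', b'⟩, ⟨h1', h2'⟩, h3⟩ := ht'
    have h3 : BinaryTree.node () a' b' = BinaryTree.node () a b := h3
    injection h3 with _ h4 h5
    subst h4 h5
    exact hxy (Prod.ext (h1.symm.trans h1') (h2.symm.trans h2'))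

theorem sum_contractSum (n : ℕ) (h : List (ℕ × Option ℕ) → ℂ) (p k j : ℕ) (hp : p ≤ k) :
    ∑ t ∈ BinaryTree.treesOfNumNodesEq n, contractSum h t p k j = 0 := by
  induction n using Nat.strong_induction_on generalizing h p k j with
  | _ n ih =>
    cases n with
    | zero => simp [contractSum, BinaryTree.numNodes]
    | succ n =>
      rw [sum_trees_succ]
      simp only [contractSum_node _ _ _ _ _ _ _ hp, Finset.sum_add_distrib, Finset.sum_sub_distrib]
      have hz1 : ∑ ij ∈ Finset.HasAntidiagonal.antidiagonal n, ∑ l ∈ BinaryTree.treesOfNumNodesEq ij.1,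
          ∑ r ∈ BinaryTree.treesOfNumNodesEq ij.2, contractSum (fun L => h ((p, none) :: (L ++
          treeEdges r (k + 1) (k + 1 + 2 * l.numNodes) (j + l.numNodes + 1)))) l (k + 1) (k + 1) j
          = 0 := by
        refine Finset.sum_eq_zero fun ij hij => ?_
        have := Finset.HasAntidiagonal.mem_antidiagonal.1 hij
        rw [Finset.sum_comm]
        refine Finset.sum_eq_zero fun r _ => ?_
        rw [← ih ij.1 (by omega) (fun L => h ((p, none) :: (L ++
          treeEdges r (k + 1) (k + 1 + 2 * ij.1) (j + ij.1 + 1)))) (k + 1) (k + 1) j le_rfl]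
        refine Finset.sum_congr rfl fun l hl => ?_
        rw [BinaryTree.mem_treesOfNumNodesEq.1 hl]
      have hz2 : ∑ ij ∈ Finset.HasAntidiagonal.antidiagonal n, ∑ l ∈ BinaryTree.treesOfNumNodesEq ij.1,
          ∑ r ∈ BinaryTree.treesOfNumNodesEq ij.2, contractSum (fun L => h ((p, none) ::
          (treeEdges l (k + 1) (k + 1) j ++ L))) r
          (k + 1) (k + 2 + 2 * l.numNodes) (j + l.numNodes + 1) = 0 := by
        refine Finset.sum_eq_zero fun ij hij => ?_
        have := Finset.HasAntidiagonal.mem_antidiagonal.1 hij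
        refine Finset.sum_eq_zero fun l _ => ?_
        exact ih ij.2 (by omega) _ _ _ _ (by omega)
      rw [hz1, hz2]
      cases n with
      | zero => simp [rightTerm, leftTerm]
      | succ m =>
        rw [Finset.Nat.sum_antidiagonal_succ', Finset.Nat.sum_antidiagonal_succ
          (f := fun ij : ℕ × ℕ => ∑ l ∈ BinaryTree.treesOfNumNodesEq ij.1,
            ∑ r ∈ BinaryTree.treesOfNumNodesEq ij.2, leftTerm h l r p k j)]
        have hc : ∀ (f : ℕ → ℕ → ℕ → ℂ),
            ∑ ij ∈ Finset.HasAntidiagonal.antidiagonal m, ∑ ab ∈ Finset.HasAntidiagonal.antidiagonal ij.1, f ab.1 ab.2 ij.2 =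
            ∑ ij ∈ Finset.HasAntidiagonal.antidiagonal m, ∑ bc ∈ Finset.HasAntidiagonal.antidiagonal ij.2, f ij.1 bc.1 bc.2 := by
          intro f
          rw [Finset.sum_sigma', Finset.sum_sigma']
          refine Finset.sum_bij' (fun x _ => ⟨(x.2.1, x.2.2 + x.1.2), (x.2.2, x.1.2)⟩)
            (fun x _ => ⟨(x.1.1 + x.2.1, x.2.2), (x.1.1, x.2.1)⟩) ?_ ?_ ?_ ?_ ?_
          · rintro ⟨⟨i, j⟩, ⟨a, b⟩⟩ hx
            simp only [Finset.mem_sigma, Finset.HasAntidiagonal.mem_antidiagonal] at hx ⊢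
            exact ⟨by omega, trivial⟩
          · rintro ⟨⟨i, j⟩, ⟨a, b⟩⟩ hx
            simp only [Finset.mem_sigma, Finset.HasAntidiagonal.mem_antidiagonal] at hx ⊢
            exact ⟨by omega, trivial⟩
          · rintro ⟨⟨i, j⟩, ⟨a, b⟩⟩ hx
            simp only [Finset.mem_sigma, Finset.HasAntidiagonal.mem_antidiagonal] at hx
            obtain ⟨-, rfl⟩ := hx
            rfl
          · rintro ⟨⟨i, j⟩, ⟨a, b⟩⟩ hx
            simp only [Finset.mem_sigma, Finset.HasAntidiagonal.mem_antidiagonal] at hx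
            obtain ⟨-, rfl⟩ := hx
            rfl
          · rintro ⟨⟨i, j⟩, ⟨a, b⟩⟩ hx
            rfl
        simp only [sum_trees_succ, leftTerm, rightTerm, BinaryTree.treesOfNumNodesEq_zero,
          Finset.sum_singleton, Finset.sum_const_zero, zero_add]
        have := hc (fun a b c => ∑ x ∈ BinaryTree.treesOfNumNodesEq a,
          ∑ y ∈ BinaryTree.treesOfNumNodesEq b, ∑ z ∈ BinaryTree.treesOfNumNodesEq c,
            h (terEdges x y z p k j))
        rw [this, sub_zero, add_zero, sub_eq_zero]
        refine Finset.sum_congr rfl fun ij _ => ?_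
        rw [Finset.sum_comm]

theorem treeEdges_fst (t : BinaryTree Unit) (p k j i : ℕ) (hi : i < 2 * t.numNodes + 1) :
    (i = 0 → (edgeAt (treeEdges t p k j) i).1 = p) ∧
    (0 < i → k < (edgeAt (treeEdges t p k j) i).1 ∧ (edgeAt (treeEdges t p k j) i).1 ≤ k + i) := by
  induction t generalizing p k j i with
  | nil =>
    simp only [BinaryTree.numNodes] at hi
    exact ⟨fun h => by simp [h, edgeAt, treeEdges], fun h => by omega⟩
  | node x l r ihl ihr =>
    refine ⟨fun h => by simp [h, edgeAt, treeEdges], fun h => ?_⟩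
    simp only [BinaryTree.numNodes] at hi
    have hA := length_treeEdges l (k + 1) (k + 1) j
    rw [treeEdges]
    by_cases hil : i - 1 < 2 * l.numNodes + 1
    · have e1 := edgeAt_cons_append_left (p, none) (treeEdges l (k + 1) (k + 1) j)
        (treeEdges r (k + 1) (k + 2 + 2 * l.numNodes) (j + l.numNodes + 1)) (i - 1) (by omega)
      rw [show 1 + (i - 1) = i by omega] at e1
      rw [e1]
      have := ihl (k + 1) (k + 1) j (i - 1) hil
      rcases Nat.eq_zero_or_pos (i - 1) with h0 | h0
      · have := this.1 h0; omega
      · have := this.2 h0; omega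
    · have e1 := edgeAt_cons_append_right (p, none) (treeEdges l (k + 1) (k + 1) j)
        (treeEdges r (k + 1) (k + 2 + 2 * l.numNodes) (j + l.numNodes + 1))
        (i - 1 - (2 * l.numNodes + 1))
      rw [hA, show 1 + (2 * l.numNodes + 1) + (i - 1 - (2 * l.numNodes + 1)) = i by omega] at e1
      rw [e1]
      have := ihr (k + 1) (k + 2 + 2 * l.numNodes) (j + l.numNodes + 1)
        (i - 1 - (2 * l.numNodes + 1)) (by omega)
      rcases Nat.eq_zero_or_pos (i - 1 - (2 * l.numNodes + 1)) with h0 | h0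
      · have := this.1 h0; omega
      · have := this.2 h0; omega

theorem treeEdges_snd (t : BinaryTree Unit) (p k j : ℕ) (x : ℕ × Option ℕ)
    (hx : x ∈ treeEdges t p k j) (m : ℕ) (hm : x.2 = some m) : m ≤ j + t.numNodes := by
  induction t generalizing p k j with
  | nil =>
    simp only [treeEdges, List.mem_singleton] at hx
    subst hx
    simp only [Option.some.injEq] at hm
    omega
  | node y l r ihl ihr =>
    simp only [treeEdges, List.mem_cons, List.mem_append] at hx
    simp only [BinaryTree.numNodes]
    rcases hx with rfl | hx | hx
    · simp at hm
    · have := ihl _ _ _ hx; omega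
    · have := ihr _ _ _ hx; omega

/-- The number of edges with upper end `q`. -/
def cnt (L : List (ℕ × Option ℕ)) (q : ℕ) : ℕ :=
  ∑ i ∈ Finset.range L.length, if (edgeAt L i).1 = q then 1 else 0

theorem cnt_cons_append (x : ℕ × Option ℕ) (A B : List (ℕ × Option ℕ)) (q : ℕ) :
    cnt (x :: (A ++ B)) q = (if x.1 = q then 1 else 0) + cnt A q + cnt B q := by
  have h : (x :: (A ++ B)).length = 1 + A.length + B.length := by simp; ring
  rw [cnt, h, Finset.sum_range_add, Finset.sum_range_add]
  refine congrArg₂ _ (congrArg₂ _ ?_ ?_) ?_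
  · rw [Finset.sum_range_one]
    rfl
  · refine Finset.sum_congr rfl fun i hi => ?_
    rw [edgeAt_cons_append_left _ _ _ _ (Finset.mem_range.1 hi)]
  · refine Finset.sum_congr rfl fun i hi => ?_
    rw [edgeAt_cons_append_right]

theorem cnt_treeEdges (t : BinaryTree Unit) (p k j q : ℕ) (hp : p ≤ k) :
    cnt (treeEdges t p k j) q = (if q = p then 1 else 0) +
      if k < q ∧ q ≤ k + (2 * t.numNodes + 1) ∧
        (edgeAt (treeEdges t p k j) (q - k - 1)).2 = none then 2 else 0 := by
  induction t generalizing p k j with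
  | nil =>
    have hs : cnt (treeEdges .nil p k j) q = if q = p then 1 else 0 := by
      rw [cnt, treeEdges, List.length_singleton, Finset.sum_range_one]
      simp [edgeAt, eq_comm]
    rw [hs]
    by_cases hq : k < q ∧ q ≤ k + (2 * 0 + 1)
    · have : q - k - 1 = 0 := by omega
      simp [treeEdges, edgeAt, this]
    · have : ¬ (k < q ∧ q ≤ k + (2 * (BinaryTree.nil : BinaryTree Unit).numNodes + 1) ∧
        (edgeAt (treeEdges .nil p k j) (q - k - 1)).2 = none) := fun h => hq ⟨h.1, h.2.1⟩
      rw [if_neg this, add_zero]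
  | node x l r ihl ihr =>
    have hA := length_treeEdges l (k + 1) (k + 1) j
    have h1 := ihl (k + 1) (k + 1) j le_rfl
    have h2 := ihr (k + 1) (k + 2 + 2 * l.numNodes) (j + l.numNodes + 1) (by omega)
    rw [treeEdges, cnt_cons_append, h1, h2]
    simp only [BinaryTree.numNodes]
    set A := treeEdges l (k + 1) (k + 1) j
    set B := treeEdges r (k + 1) (k + 2 + 2 * l.numNodes) (j + l.numNodes + 1)
    rcases lt_trichotomy q (k + 1) with hq | hq | hq
    · have c1 : ¬ k < q := by omega
      have c2 : ¬ k + 1 < q := by omega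
      have c3 : ¬ k + 2 + 2 * l.numNodes < q := by omega
      have c4 : ¬ q = k + 1 := by omega
      simp [c1, c2, c3, c4, eq_comm]
    · subst hq
      have c3 : ¬ k + 2 + 2 * l.numNodes < k + 1 := by omega
      have c5 : ¬ p = k + 1 := by omega
      have c6 : ¬ k + 1 = p := by omega
      have c7 : (edgeAt ((p, none) :: (A ++ B)) 0).2 = none := by simp [edgeAt]
      simp [c3, c5, c6, c7]
    · have c4 : ¬ q = k + 1 := by omega
      have c5 : ¬ p = q := by omega
      have c6 : ¬ q = p := by omega
      have c7 : k < q := by omega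
      by_cases hq2 : q ≤ k + 2 + 2 * l.numNodes
      · have c3 : ¬ k + 2 + 2 * l.numNodes < q := by omega
        have e1 := edgeAt_cons_append_left (p, none) A B (q - (k + 1) - 1) (by omega)
        rw [show 1 + (q - (k + 1) - 1) = q - k - 1 by omega] at e1
        have c8 : q ≤ k + 1 + (2 * l.numNodes + 1) := by omega
        have c9 : q ≤ k + (2 * (l.numNodes + r.numNodes + 1) + 1) := by omega
        simp [c3, c4, c5, c6, c7, hq, e1, c8, c9]
      · have c3 : k + 2 + 2 * l.numNodes < q := by omega
        have e1 := edgeAt_cons_append_right (p, none) A B (q - (k + 2 + 2 * l.numNodes) - 1)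
        have c8 : ¬ q ≤ k + 1 + (2 * l.numNodes + 1) := by omega
        have c9 : q ≤ k + 2 + 2 * l.numNodes + (2 * r.numNodes + 1) ↔
          q ≤ k + (2 * (l.numNodes + r.numNodes + 1) + 1) := by omega
        rw [hA, show 1 + (2 * l.numNodes + 1) + (q - (k + 2 + 2 * l.numNodes) - 1) = q - k - 1 by
          omega] at e1
        simp [c3, c4, c5, c6, c7, e1, c8, c9]

theorem val_ofEdges (w : List S) (L : List (ℕ × Option ℕ)) (hL : L.length = e) (h : HalfEdge e)
    (q : ℕ) (hq : (if h.2 then (h.1 : ℕ) + 1 else (edgeAt L h.1).1) = q) :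
    (ofEdges e w L).val h = (if 0 < q ∧ q ≤ e then 1 else 0) + cnt L q := by
  have h1 : {h' | (ofEdges e w L).vtx h h'} = {h' : HalfEdge e | (if h'.2 then (h'.1 : ℕ) + 1 else
      (edgeAt L h'.1).1) = q} := by
    ext h'
    change (if h.2 then (h.1 : ℕ) + 1 else (edgeAt L h.1).1) =
      (if h'.2 then (h'.1 : ℕ) + 1 else (edgeAt L h'.1).1) ↔ _
    rw [hq]
    exact eq_comm
  rw [val, h1, Set.ncard_eq_toFinset_card', Set.toFinset_ofPred, Finset.card_filter,
    Fintype.sum_prod_type]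
  simp only [Fintype.sum_bool, if_true, Finset.sum_add_distrib, Bool.false_eq_true, if_false]
  rw [Fin.sum_univ_eq_sum_range (fun i => if i + 1 = q then 1 else 0) e,
    Fin.sum_univ_eq_sum_range (fun i => if (edgeAt L i).1 = q then 1 else 0) e, cnt, hL]
  congr 1
  split_ifs with h2
  · rw [Finset.sum_eq_single (q - 1)]
    · rw [if_pos (by omega)]
    · intro b _ hb
      rw [if_neg (by omega)]
    · intro hb
      rw [Finset.mem_range] at hb
      omega
  · refine Finset.sum_eq_zero fun i hi => ?_
    rw [Finset.mem_range] at hi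
    rw [if_neg (by omega)]

section TreeGraph

variable (n : ℕ) (w : List S) (t : BinaryTree Unit)

theorem treeGraph_val_true (hn : t.numNodes = n) (i : Fin (2 * n + 1)) :
    (treeGraph (2 * n + 1) w t).val (i, true) =
      if (edgeAt (treeEdges t 0 0 1) i).2 = none then 3 else 1 := by
  subst hn
  have hi := i.isLt
  rw [treeGraph, val_ofEdges w _ (length_treeEdges _ _ _ _) (i, true) (i + 1) (by simp),
    cnt_treeEdges _ _ _ _ _ le_rfl, if_pos (by omega), if_neg (by omega)]
  have : (i : ℕ) + 1 - 0 - 1 = i := by omega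
  have h2 : (i : ℕ) + 1 ≤ 0 + (2 * t.numNodes + 1) := by omega
  rw [this]
  by_cases h : (edgeAt (treeEdges t 0 0 1) i).2 = none
  · rw [if_pos ⟨by omega, h2, h⟩, if_pos h]
  · rw [if_neg (fun h' => h h'.2.2), if_neg h]

theorem treeGraph_val_false (hn : t.numNodes = n) (i : Fin (2 * n + 1)) :
    (treeGraph (2 * n + 1) w t).val (i, false) = if (i : ℕ) = 0 then 1 else 3 := by
  subst hn
  have hi := i.isLt
  have hf := treeEdges_fst t 0 0 1 i hi
  rw [treeGraph, val_ofEdges w _ (length_treeEdges _ _ _ _) (i, false)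
    (edgeAt (treeEdges t 0 0 1) i).1 (by simp)]
  split_ifs with h1 h0 h0
  · have := hf.1 h0; omega
  · have hc : 0 < cnt (treeEdges t 0 0 1) (edgeAt (treeEdges t 0 0 1) i).1 := by
      rw [cnt, length_treeEdges]
      refine Finset.sum_pos' (fun _ _ => Nat.zero_le _) ⟨i, by simpa using hi, by simp⟩
    rw [cnt_treeEdges _ _ _ _ _ le_rfl] at hc ⊢
    rw [if_neg (by omega)] at hc ⊢
    split_ifs at hc ⊢ <;> omega
  · rw [hf.1 h0, cnt_treeEdges _ _ _ _ _ le_rfl]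
    simp
  · have := hf.2 (by omega)
    omega

theorem treeGraph_isFeynman (hw : w.length = n + 2) (hn : t.numNodes = n) :
    (treeGraph (2 * n + 1) w t).IsFeynman := by
  have hT := treeGraph_val_true n w t hn
  have hF := treeGraph_val_false n w t hn
  have huni : (treeGraph (2 * n + 1) w t).IsUniTrivalent := by
    rintro ⟨i, b⟩
    cases b
    · rw [hF]; split_ifs <;> simp
    · rw [hT]; split_ifs <;> simp
  have hfst : ∀ i : Fin (2 * n + 1), _ := fun i =>
    treeEdges_fst t 0 0 1 i (by rw [hn]; exact i.isLt)
  refine ⟨⟨fun h => ?_, ?_⟩, huni, ⟨by omega, ?_⟩, ?_⟩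
  · rcases huni h with h1 | h1 <;> omega
  · rintro ⟨i, b⟩
    cases b
    · rw [hF]
      change (if (i : ℕ) = 0 then w[0]? else none).isSome ↔ _
      split_ifs with h0
      · simp [hw]
      · simp
    · rw [hT]
      change ((edgeAt (treeEdges t 0 0 1) i).2.bind (w[·]?)).isSome ↔ _
      rcases hx : (edgeAt (treeEdges t 0 0 1) i).2 with _ | m
      · simp
      · have hi : (i : ℕ) < (treeEdges t 0 0 1).length := by
          rw [length_treeEdges, hn]; exact i.isLt
        have hmem : edgeAt (treeEdges t 0 0 1) i ∈ treeEdges t 0 0 1 := by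
          rw [edgeAt, List.getD_eq_getElem _ _ hi]
          exact List.getElem_mem hi
        have := treeEdges_snd t 0 0 1 _ hmem m hx
        simp only [Option.bind_some, reduceCtorEq, if_false, iff_true]
        simp [hw]
        omega
  · have key : ∀ (k : ℕ) (i : Fin (2 * n + 1)), (i : ℕ) = k → ∀ b, Relation.EqvGen
        (fun a b => (treeGraph (2 * n + 1) w t).vtx a b ∨ b = a.flip) (0, false) (i, b) := by
      intro k
      induction k using Nat.strong_induction_on with
      | _ k ih =>
        intro i hi
        have hflip : ∀ b, Relation.EqvGen
            (fun a b => (treeGraph (2 * n + 1) w t).vtx a b ∨ b = a.flip) (0, false) (i, false) →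
            Relation.EqvGen (fun a b => (treeGraph (2 * n + 1) w t).vtx a b ∨ b = a.flip)
              (0, false) (i, b) := by
          intro b h
          cases b
          · exact h
          · exact h.trans _ _ _ (.rel _ _ (.inr rfl))
        intro b
        apply hflip
        rcases Nat.eq_zero_or_pos (i : ℕ) with h0 | h0
        · rw [show i = 0 from Fin.ext h0]
          exact .refl _
        · have hp := (hfst i).2 h0
          have := i.isLt
          refine (ih ((edgeAt (treeEdges t 0 0 1) i).1 - 1) (by omega)
            ⟨(edgeAt (treeEdges t 0 0 1) i).1 - 1, by omega⟩ rfl true).trans _ _ _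
            (.rel _ _ (.inl ?_))
          change (edgeAt (treeEdges t 0 0 1) i).1 - 1 + 1 = (edgeAt (treeEdges t 0 0 1) i).1
          omega
    intro a b
    exact ((key _ a.1 rfl a.2).symm _ _).trans _ _ _ (key _ b.1 rfl b.2)
  · rintro ⟨i, hi⟩
    have hi : (edgeAt (treeEdges t 0 0 1) i).1 = i + 1 := hi
    rcases Nat.eq_zero_or_pos (i : ℕ) with h0 | h0
    · have := (hfst i).1 h0; omega
    · have := (hfst i).2 h0; omega

end TreeGraph

/-- The sum over the planar uni-trivalent trees decorated by `w` is a cocycle. -/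
theorem sum_treeGraph_of_mem_IHX (n : ℕ) (w : List S) (hw : w.length = n + 2)
    (f : CD S 0 (2 * n + 1)) (hf : f ∈ IHX S (2 * n + 1)) :
    ∑ t ∈ BinaryTree.treesOfNumNodesEq n, f.1 (treeGraph (2 * n + 1) w t) = 0 := by
  obtain ⟨g, -, hg⟩ := hf
  rw [← sum_contractSum n (fun L => g (ofEdges (2 * n) w L)) 0 0 1 le_rfl]
  refine Finset.sum_congr rfl fun t ht => ?_
  have ht := BinaryTree.mem_treesOfNumNodesEq.1 ht
  rw [hg _ (treeGraph_isFeynman n w t hw ht), contractSum, ht,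
    ← Fin.sum_univ_eq_sum_range (fun c => if 0 < c ∧ (edgeAt (treeEdges t 0 0 1) c).2 = none then
      (-1) ^ c * g (ofEdges (2 * n) w (contractEdges (0 + c) c (treeEdges t 0 0 1))) else 0)]
  refine Finset.sum_congr rfl fun c _ => ?_
  have hint : (treeGraph (2 * n + 1) w t).IsInternalEdge c ↔
      0 < (c : ℕ) ∧ (edgeAt (treeEdges t 0 0 1) c).2 = none := by
    rw [IsInternalEdge, Bool.forall_bool, treeGraph_val_true n w t ht, treeGraph_val_false n w t ht]
    by_cases h0 : (c : ℕ) = 0 <;> by_cases h1 : (edgeAt (treeEdges t 0 0 1) c).2 = none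
    · rw [if_pos h0, if_pos h1]; simp [h0]
    · rw [if_pos h0, if_neg h1]; simp [h1]
    · rw [if_neg h0, if_pos h1]
      exact ⟨fun _ => ⟨by omega, h1⟩, fun _ => ⟨by omega, by omega⟩⟩
    · rw [if_neg h0, if_neg h1]; simp [h1]
  by_cases hc : 0 < (c : ℕ) ∧ (edgeAt (treeEdges t 0 0 1) c).2 = none
  · have hP := (treeEdges_fst t 0 0 1 c (by rw [ht]; exact c.isLt)).2 hc.1
    rw [if_pos (hint.2 hc), if_pos hc, treeGraph, contract_ofEdges w _ (by
      rw [length_treeEdges, ht]) c hc.1 (by omega), zero_add]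
  · rw [if_neg (fun h => hc (hint.1 h)), if_neg hc]

/-! ### Cyclic words -/

/-- The value of a class at the sum over all planar uni-trivalent trees decorated by `w`. -/
noncomputable def treePairing (w : List S) (hw : 2 ≤ w.length) :
    H0 S (2 * (w.length - 2) + 1) →ₗ[ℂ] ℂ :=
  (IHX S (2 * (w.length - 2) + 1)).liftQ
    { toFun := fun f => ∑ t ∈ BinaryTree.treesOfNumNodesEq (w.length - 2),
        f.1 (treeGraph (2 * (w.length - 2) + 1) w t)
      map_add' := fun f g => by simp [Finset.sum_add_distrib]
      map_smul' := fun a f => by simp [Finset.mul_sum] }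
    fun f hf => sum_treeGraph_of_mem_IHX _ w (by omega) f hf

open Classical in
/-- The number of rotations that fix a cyclic word. -/
noncomputable def cyclicAutCard (W : Cycle S) : ℕ :=
  ((Finset.range (Quotient.out W).length).filter
    fun i => (Quotient.out W).rotate i = Quotient.out W).card

/-- The pullback along `F`, which maps a cyclic word to the sum of all planar uni-trivalent trees
decorated by it. The result is an infinite linear combination `∑ c_W W` of cyclic words, given by its
coefficients; the pairing of `W` with itself is `|Aut W|`. -/
noncomputable def pullF (s : H0hat S) : Cycle S → ℂ := fun W =>
  if hW : 2 ≤ (Quotient.out W).length then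
    1 / (cyclicAutCard W : ℂ) * treePairing (Quotient.out W) hW (s _) else 0

/-! ### Differential forms -/

/-- Inhomogeneous differential forms, as functions of the degree `r`, a point and `r` tangent
vectors. -/
abbrev Form (E V : Type*) : Type _ := (r : ℕ) → E → (Fin r → E) → V

/-- The form of degree one given by `α`. -/
def Form.ofDegreeOne {E V : Type*} [Zero V] (α : E → E → V) : Form E V := fun r p v =>
  if h : r = 1 then α p (v ⟨0, by omega⟩) else 0

/-- Pullback along a holomorphic map. -/
noncomputable def Form.pullback {E E' V : Type*} [NormedAddCommGroup E] [NormedSpace ℂ E]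
    [NormedAddCommGroup E'] [NormedSpace ℂ E'] (φ : E → E') (ω : Form E' V) : Form E V :=
  fun r p v => ω r (φ p) fun i => fderiv ℂ φ p (v i)

/-- Restriction of a form on `B × ℂ²` to the twistor line `{(1 - u, u)}`. -/
def Form.twistorLine {E V : Type*} (ω : Form (E × (ℂ × ℂ)) V) : Form (E × ℂ) V :=
  fun r p v => ω r (p.1, (1 - p.2, p.2)) fun i => ((v i).1, (-(v i).2, (v i).2))

/-- Restriction of a form on `B × ℂ` to the slice `B × {u}`. -/
def Form.slice {E V : Type*} (u : ℂ) (ω : Form (E × ℂ) V) : Form E V :=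
  fun r p v => ω r (p, u) fun i => (v i, 0)

section Dolbeault

variable {E : Type*} [NormedAddCommGroup E] [NormedSpace ℝ E] [NormedSpace ℂ E]
  [IsScalarTower ℝ ℂ E]

/-- `∂ f` at the point `p` on the tangent vector `η`. -/
noncomputable def dHol (f : E → ℂ) (p η : E) : ℂ :=
  (fderiv ℝ f p η - Complex.I * fderiv ℝ f p (Complex.I • η)) / 2

/-- `∂̄ f` at the point `p` on the tangent vector `η`. -/
noncomputable def dAnti (f : E → ℂ) (p η : E) : ℂ :=
  (fderiv ℝ f p η + Complex.I * fderiv ℝ f p (Complex.I • η)) / 2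

end Dolbeault

/-- The Green function of the projective line with base point `∞`, normalized by the tangent vector
at `∞` that is dual to the differential of the coordinate `1 / x`. -/
noncomputable def green (x y : ℂ) : ℂ := 1 / (2 * Real.pi * Complex.I) * (Real.log (‖x - y‖ ^ 2) : ℝ)

section Feynman

variable [Fintype S]

/-- The numbering of the internal vertices. -/
noncomputable def DGraph.vertexEquiv (Γ : DGraph S e) : Γ.IntVertex ≃ Fin Γ.numInt :=
  Finite.equivFin _

open Classical in
/-- The position of the vertex that carries the half-edge `h`, where `y.1` are the positions of the
internal vertices and `y.2` those of the marked points. -/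
noncomputable def DGraph.position (Γ : DGraph S e) (h : HalfEdge e)
    (y : (Fin Γ.numInt → ℂ) × (S → ℂ)) : ℂ :=
  match Γ.dec h with
  | some a => y.2 a
  | none => if hh : Γ.val h ≠ 1 then y.1 (Γ.vertexEquiv ⟨Quotient.mk Γ.vtx h, h, hh, rfl⟩) else 0

/-- The Green function pulled back along the edge `i`. -/
noncomputable def DGraph.edgeGreen (Γ : DGraph S e) (i : Fin e)
    (y : (Fin Γ.numInt → ℂ) × (S → ℂ)) : ℂ :=
  green (Γ.position (i, false) y) (Γ.position (i, true) y)

/-- The twistor propagator `(w ∂ - z ∂̄) G + (z dw - w dz) G` of the edge `i` at the point `(y, q)`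
with `q = (z, w)`, on the tangent vector `η`. -/
noncomputable def DGraph.propagator (Γ : DGraph S e) (i : Fin e)
    (y : (Fin Γ.numInt → ℂ) × (S → ℂ)) (q : ℂ × ℂ)
    (η : ((Fin Γ.numInt → ℂ) × (S → ℂ)) × (ℂ × ℂ)) : ℂ :=
  q.2 * dHol (Γ.edgeGreen i) y η.1 - q.1 * dAnti (Γ.edgeGreen i) y η.1
    + (q.1 * η.2.2 - q.2 * η.2.1) * Γ.edgeGreen i y

/-- The tangent vectors `∂/∂ Re x₀, ∂/∂ Im x₀, ∂/∂ Re x₁, …` of the fibre, followed by the lifts of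
the tangent vectors `v` of the base. -/
noncomputable def DGraph.frame (Γ : DGraph S e) {r : ℕ} (v : Fin r → (S → ℂ) × (ℂ × ℂ)) (j : ℕ) :
    ((Fin Γ.numInt → ℂ) × (S → ℂ)) × (ℂ × ℂ) :=
  if h : j / 2 < Γ.numInt then
    ((Pi.single ⟨j / 2, h⟩ (if j % 2 = 0 then 1 else Complex.I), 0), 0)
  else if h : j - 2 * Γ.numInt < r then
    ((0, (v ⟨j - 2 * Γ.numInt, h⟩).1), (v ⟨j - 2 * Γ.numInt, h⟩).2)
  else 0

/-- The configurations of the internal vertices: pairwise distinct points of `ℂ` that differ from the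
marked points. -/
def confSpace (k : ℕ) (s : S → ℂ) : Set (Fin k → ℂ) :=
  {x | Function.Injective x ∧ ∀ i a, x i ≠ s a}

open Classical MeasureTheory in
/-- The integral along the fibre of `ω_{E₀} ∧ ⋯ ∧ ω_{E_{e-1}}`. -/
noncomputable def DGraph.amplitude (Γ : DGraph S e) : Form ((S → ℂ) × (ℂ × ℂ)) ℂ := fun r b v =>
  if ¬ Γ.HasSelfLoop ∧ ¬ Γ.IsConstEdge ∧ e = 2 * Γ.numInt + r then
    ∫ x in confSpace Γ.numInt b.1,
      Matrix.det (Matrix.of fun i j : Fin e => Γ.propagator i (x, b.1) b.2 (Γ.frame v j))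
  else 0

variable (S)

open Classical in
/-- The sum of `Z_Γ / |Aut Γ| · [Γ^∨]` over the isomorphism classes of connected decorated
uni-trivalent graphs `Γ` with `l` loops. -/
noncomputable def effPart (l : ℤ) : Form ((S → ℂ) × (ℂ × ℂ)) (H0hat S) := fun r b v e =>
  ∑ᶠ q : Quotient (isoSetoid S e),
    if (Quotient.out q).IsFeynman ∧ (Quotient.out q).loops = l then
      ((Quotient.out q).amplitude r b v / ((Quotient.out q).autCard : ℂ)) •
        Submodule.Quotient.mk (dualGraph (Quotient.out q))
    else 0

/-- The tree part. -/
noncomputable def effTree : Form ((S → ℂ) × (ℂ × ℂ)) (H0hat S) := effPart S 0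

/-- The coefficient of `ħ`. -/
noncomputable def effLoop : Form ((S → ℂ) × (ℂ × ℂ)) (H0hat S) := effPart S 1

/-- The effective action `S_tree + ħ S_1-loop`, a form with values in series in `ħ`, which are given
by their coefficients. -/
noncomputable def effAction : Form ((S → ℂ) × (ℂ × ℂ)) (ℕ → H0hat S) := fun r b v =>
  Pi.single 0 (effTree S r b v) + Pi.single 1 (effLoop S r b v)

/-- The Hodge correlator class. -/
noncomputable def hodgeCorrelator : Form ((S → ℂ) × (ℂ × ℂ)) (Cycle S → ℂ) := fun r b v W =>
  if 2 ≤ (Quotient.out W).length then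
    1 / (cyclicAutCard W : ℂ) *
      ∑ t ∈ BinaryTree.treesOfNumNodesEq ((Quotient.out W).length - 2),
        (treeGraph (2 * ((Quotient.out W).length - 2) + 1) (Quotient.out W) t).amplitude r b v
  else 0

end Feynman

/-! ### The moduli spaces -/

/-- The moduli space of the projective line with `n` marked points `s₀, …, s_{n-1}` and a nonzero
tangent vector at `s₀`: by the action of the group of projective transformations, `s₀ = ∞`, the
tangent vector is the one dual to the differential of the coordinate `1 / x`, and `s₁ = 0`. The entry
with index `i` is the point `s_{i+1}`. -/
def moduli (n : ℕ) : Set (Fin (n - 1) → ℂ) :=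
  {s | Function.Injective s ∧ ∀ i : Fin (n - 1), (i : ℕ) = 0 → s i = 0}

/-- The tangent vectors of the moduli space. -/
def moduliTangent (n : ℕ) : Set (Fin (n - 1) → ℂ) :=
  {ξ | ∀ i : Fin (n - 1), (i : ℕ) = 0 → ξ i = 0}

/-- The projective transformation that maps `z` to `∞` and `0` to `0` and that maps the tangent vector
`v` at `z` to the one dual to the differential of the coordinate `1 / x` at `∞`. It maps `∞` to
`v / z`. -/
noncomputable def normalize (z v x : ℂ) : ℂ := v / (x - z) + v / z

/-- The projective line with marked points `z, 0, 1, ∞` and the tangent vector `v` at `z`, as a point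
of the moduli space. -/
noncomputable def crossRatioMap (p : ℂ × ℂ) : Fin 3 → ℂ :=
  ![normalize p.1 p.2 0, normalize p.1 p.2 1, p.2 / p.1]

/-! ### Special derivations -/

/-- The tensor algebra on `X₀` and `X₁`. -/
abbrev Alg : Type := FreeAlgebra ℂ (Fin 2)

/-- The letters `X₀`, `X₁` and `X_∞ = - X₀ - X₁`. -/
noncomputable def letter : Fin 3 → Alg :=
  ![FreeAlgebra.ι ℂ 0, FreeAlgebra.ι ℂ 1, - FreeAlgebra.ι ℂ 0 - FreeAlgebra.ι ℂ 1]

open Classical in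
/-- The cyclic words of length `m`. -/
noncomputable def cyclicWords (m : ℕ) : Finset (Cycle (Fin 3)) :=
  Finset.univ.image fun x : Fin m → Fin 3 => (List.ofFn x : Cycle (Fin 3))

/-- If the first letter of a word is `X_s`, the product of the others. -/
noncomputable def dropLetter (s : Fin 3) : List (Fin 3) → Alg
  | [] => 0
  | a :: l => if a = s then (l.map letter).prod else 0

/-- The cyclic derivative with respect to `X_s` of the part of length `m` of `∑ c_W W`. -/
noncomputable def cyclicDeriv (c : Cycle (Fin 3) → ℂ) (m : ℕ) (s : Fin 3) : Alg :=
  ∑ W ∈ cyclicWords m, c W • ((Cycle.lists W).map (dropLetter s)).sum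

/-- The derivation of the free algebra with the values `D` on the generators: the upper right entry
of the homomorphism with `X_i ↦ (X_i, D i; 0, X_i)`. -/
noncomputable def derivationOf (D : Fin 2 → Alg) : Module.End ℂ Alg where
  toFun x := FreeAlgebra.lift ℂ (fun i : Fin 2 =>
    (!![FreeAlgebra.ι ℂ i, D i; 0, FreeAlgebra.ι ℂ i] : Matrix (Fin 2) (Fin 2) Alg)) x 0 1
  map_add' x y := by simp
  map_smul' a x := by simp

/-- The special derivation `X_s ↦ [X_s, ∂F/∂X_s]` for `F = ∑ c_W W`, given by its homogeneous parts;
the part with index `m` comes from the words of length `m`. -/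
noncomputable def specialDer (c : Cycle (Fin 3) → ℂ) (m : ℕ) : Module.End ℂ Alg :=
  derivationOf fun i => ⁅FreeAlgebra.ι ℂ i, cyclicDeriv c m i.castSucc⁆

/-- The adjoint action from the right, `Y ↦ [Y, X]`. -/
noncomputable def rightAd (X : Alg) : Module.End ℂ Alg where
  toFun Y := ⁅Y, X⁆
  map_add' Y Z := by simp only [Ring.lie_def, add_mul, mul_add]; abel
  map_smul' a Y := by simp [Ring.lie_def, smul_sub]

/-- The formal KZ connection `(2πi)⁻¹ (dz / z · X₀ + dz / (z - 1) · X₁)` on the tangent vector `ζ`. -/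
noncomputable def kzForm (z ζ : ℂ) : Alg :=
  (1 / (2 * Real.pi * Complex.I)) •
    ((ζ / z) • FreeAlgebra.ι ℂ (0 : Fin 2) + (ζ / (z - 1)) • FreeAlgebra.ι ℂ (1 : Fin 2))

/-- The complex conjugate of the formal KZ connection, the letters being real. -/
noncomputable def kzFormConj (z ζ : ℂ) : Alg :=
  (starRingEnd ℂ (1 / (2 * Real.pi * Complex.I))) •
    ((starRingEnd ℂ (ζ / z)) • FreeAlgebra.ι ℂ (0 : Fin 2) +
      (starRingEnd ℂ (ζ / (z - 1))) • FreeAlgebra.ι ℂ (1 : Fin 2))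

end HodgeCorr

open HodgeCorr

/-! On a slice of the twistor line the term `(z dw - w dz) G` of the propagator drops out, and at `u
= 1` and `u = 0` what is left is `∂ G` and `-∂̄ G`, of pure type `(1, 0)` or `(0, 1)`. An integral
over the position of an internal vertex needs both its real and its imaginary direction. A form of
pure type takes proportional values on these two vectors, with the same factor for every edge. Hence
two columns of the determinant are proportional and the integrand vanishes pointwise
(`DGraph.amplitude_slice_eq_zero`), so that convergence of the integrals plays no role.

Only connected graphs without internal vertices survive, that is, single edges. A single edge has no
loop, which removes the one-loop part. For the tree part and the Hodge correlator only words of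
length two remain. There the sum over isomorphism classes reduces to one class, whose weight `1 /
|Aut|` cancels against the number of isomorphisms counted by the dual functional
(`treePairing_effTree`).

The amplitude of an edge with distinct labels `a`, `b` is `(2πi)⁻¹ d log (s_a - s_b)` at `u = 1` and
its complex conjugate at `u = 0` (`DGraph.IsFeynman.amplitude_edge`). For four points the
differences of the marked points are, up to sign, `v / (z (1 - z))`, `v / (1 - z)` and `v / z`. The
relation `X_∞ = -X₀ - X₁` turns the quadratic cyclic words into an inner derivation whose
coefficients are differences of these logarithmic forms (`specialDer_two`). The contribution of `v`
cancels, and `-dz / z` and `-dz / (z - 1)` remain (`specialDer_hodgeCorrelator`). -/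

namespace HodgeCorr
open DGraph

/-! ### Complex linearity of `∂ f` and antilinearity of `∂̄ f`. -/

section Dolbeault

variable {E : Type*} [NormedAddCommGroup E] [NormedSpace ℝ E] [NormedSpace ℂ E]

/-- Linearity of the real derivative and `I ^ 2 = -1` suffice, so no differentiability of `f` is
needed. In particular the singularities of the Green function cause no exceptions. -/
theorem dHol_I_smul (f : E → ℂ) (p η : E) :
    dHol f p (Complex.I • η) = Complex.I * dHol f p η := by
  have h : Complex.I • Complex.I • η = -η := by rw [smul_smul, Complex.I_mul_I, neg_one_smul]
  rw [dHol, dHol, h, map_neg]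
  linear_combination (1 / 2) * fderiv ℝ f p (Complex.I • η) * Complex.I_mul_I

theorem dAnti_I_smul (f : E → ℂ) (p η : E) :
    dAnti f p (Complex.I • η) = -Complex.I * dAnti f p η := by
  have h : Complex.I • Complex.I • η = -η := by rw [smul_smul, Complex.I_mul_I, neg_one_smul]
  rw [dAnti, dAnti, h, map_neg]
  linear_combination (1 / 2) * fderiv ℝ f p (Complex.I • η) * Complex.I_mul_I

end Dolbeault

/-! ### Vanishing of the fibre integrals over internal vertices. -/

section Slice

variable {S : Type*} {e : ℕ}

/-- The first two frame vectors are the real and the imaginary direction of the internal vertex with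
number `0`, so they span one complex line. -/
theorem DGraph.frame_one (Γ : DGraph S e) (h : 0 < Γ.numInt) {r : ℕ}
    (v : Fin r → (S → ℂ) × (ℂ × ℂ)) : Γ.frame v 1 = Complex.I • Γ.frame v 0 := by
  simp [frame, h, ← Pi.single_smul]

theorem DGraph.frame_zero_snd (Γ : DGraph S e) (h : 0 < Γ.numInt) {r : ℕ}
    (v : Fin r → (S → ℂ) × (ℂ × ℂ)) : (Γ.frame v 0).2 = 0 := by
  simp [frame, h]

variable [Fintype S]

/-- At the ends of the twistor line the propagators are of type `(1, 0)` or `(0, 1)`, so that the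
fibre integrals over configuration spaces of positive dimension vanish. -/
theorem DGraph.amplitude_slice_eq_zero (Γ : DGraph S e) (hΓ : 0 < Γ.numInt) {u : ℂ}
    (hu : u = 0 ∨ u = 1) (r : ℕ) (s : S → ℂ) (ξ : Fin r → S → ℂ) :
    Γ.amplitude.twistorLine.slice u r s ξ = 0 := by
  simp only [Form.slice, Form.twistorLine, amplitude]
  split_ifs with h
  · obtain ⟨-, -, he⟩ := h
    refine (MeasureTheory.integral_congr_ae (.of_forall fun x => ?_)).trans
      (MeasureTheory.integral_zero _ _)
    -- The factor `c` must not depend on the edge, since it relates two whole columns. It is `-I`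
    -- for the type `(0, 1)` and `I` for the type `(1, 0)`.
    obtain ⟨c, hc⟩ : ∃ c : ℂ, ∀ i : Fin e, ∀ η : ((Fin Γ.numInt → ℂ) × (S → ℂ)) × (ℂ × ℂ),
        η.2 = 0 → Γ.propagator i (x, s) (1 - u, u) (Complex.I • η) =
          c * Γ.propagator i (x, s) (1 - u, u) η := by
      rcases hu with rfl | rfl
      · refine ⟨-Complex.I, fun i η hη => ?_⟩
        simp [propagator, hη, dAnti_I_smul]
      · refine ⟨Complex.I, fun i η hη => ?_⟩
        simp [propagator, hη, dHol_I_smul]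
    -- Both columns exist because `e = 2 * numInt + r` and `numInt` is positive.
    have h01 : (⟨1, by omega⟩ : Fin e) ≠ ⟨0, by omega⟩ := by simp
    -- Column `1` is `c` times column `0`, which gives an explicit nonzero vector in the kernel.
    refine Matrix.exists_mulVec_eq_zero_iff.1
      ⟨Pi.single ⟨1, by omega⟩ 1 - c • Pi.single ⟨0, by omega⟩ 1, fun h0 => ?_, ?_⟩
    · have := congrFun h0 ⟨1, by omega⟩
      simp at this
    · ext i
      simp only [Matrix.mulVec_sub, Matrix.mulVec_smul, Matrix.mulVec_single_one, Pi.sub_apply,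
        Pi.smul_apply, Matrix.col_apply, Matrix.of_apply, smul_eq_mul, Pi.zero_apply]
      rw [Γ.frame_one hΓ, hc _ _ (Γ.frame_zero_snd hΓ _), sub_self]
  · rfl

end Slice

/-! ### Graphs without internal vertices and the amplitude of a single edge. -/

section OneEdge

variable {S : Type*} {e : ℕ}

theorem DGraph.val_eq_one_of_numInt (Γ : DGraph S e) (h0 : Γ.numInt = 0) (h : HalfEdge e) :
    Γ.val h = 1 := by
  by_contra hh
  have : IsEmpty Γ.IntVertex := by
    rcases (Nat.card_eq_zero.1 h0) with h | h
    · exact h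
    · exact absurd h (not_infinite_iff_finite.2 inferInstance)
  exact this.false ⟨Quotient.mk Γ.vtx h, h, hh, rfl⟩

theorem DGraph.numInt_eq_zero (Γ : DGraph S e) (h : ∀ h, Γ.val h = 1) : Γ.numInt = 0 := by
  have : IsEmpty Γ.IntVertex := ⟨fun ⟨_, h', h1, _⟩ => h1 (h h')⟩
  exact Nat.card_of_isEmpty

theorem DGraph.eq_of_vtx (Γ : DGraph S e) {a b : HalfEdge e} (h : Γ.val a = 1) (hab : Γ.vtx a b) :
    a = b := by
  obtain ⟨x, hx⟩ := Set.ncard_eq_one.1 h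
  have ha : a ∈ {h' | Γ.vtx a h'} := Γ.vtx.refl' a
  have hb : b ∈ {h' | Γ.vtx a h'} := hab
  rw [hx] at ha hb
  exact ha.trans hb.symm

/-- A connected graph without internal vertices is a single edge. -/
theorem DGraph.IsConnected.eq_one {Γ : DGraph S e} (hc : Γ.IsConnected) (h0 : Γ.numInt = 0) :
    e = 1 := by
  -- Passing to the other half keeps the edge. Passing to another half-edge at the same vertex is
  -- trivial when all valencies are `1`. So a path never leaves its edge.
  have key : ∀ a b, Relation.EqvGen (fun a b => Γ.vtx a b ∨ b = a.flip) a b → a.1 = b.1 := by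
    intro a b h
    induction h with
    | rel a b h =>
      rcases h with h | rfl
      · rw [Γ.eq_of_vtx (Γ.val_eq_one_of_numInt h0 a) h]
      · rfl
    | refl => rfl
    | symm _ _ _ ih => exact ih.symm
    | trans _ _ _ _ _ ih1 ih2 => exact ih1.trans ih2
  have he := hc.1
  by_contra h1
  have := key _ _ (hc.2 (⟨0, he⟩, false) (⟨1, by omega⟩, false))
  simp at this

theorem DGraph.numExt_of_numInt (Γ : DGraph S e) (h0 : Γ.numInt = 0) : Γ.numExt = 2 * e := by
  have : {h | Γ.val h = 1} = Set.univ := Set.eq_univ_of_forall (Γ.val_eq_one_of_numInt h0)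
  rw [numExt, this, Set.ncard_univ, Nat.card_eq_fintype_card]
  simp [mul_comm]

/-- One edge has only two half-edges, too few for a trivalent vertex. -/
theorem DGraph.IsFeynman.val_one {Γ : DGraph S 1} (hΓ : Γ.IsFeynman) (h : HalfEdge 1) :
    Γ.val h = 1 := by
  rcases hΓ.2.1 h with h1 | h1
  · exact h1
  · have : Γ.val h ≤ 2 := by
      refine (Set.ncard_le_card _).trans ?_
      simp
    omega

theorem DGraph.IsFeynman.exists_dec {Γ : DGraph S 1} (hΓ : Γ.IsFeynman) :
    ∃ a b, Γ.dec (0, false) = some a ∧ Γ.dec (0, true) = some b := by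
  obtain ⟨a, ha⟩ := Option.isSome_iff_exists.1 ((hΓ.1.2 (0, false)).2 (hΓ.val_one _))
  obtain ⟨b, hb⟩ := Option.isSome_iff_exists.1 ((hΓ.1.2 (0, true)).2 (hΓ.val_one _))
  exact ⟨a, b, ha, hb⟩

/-- The space `Fin 0 → ℂ` is a point of mass one, and the conditions on configurations are empty
there. The equality `k = 0` is a hypothesis because `k` will be the number of internal vertices of a
graph. -/
theorem integral_confSpace_zero {k : ℕ} (hk : k = 0) (s : S → ℂ) (f : (Fin k → ℂ) → ℂ) (c : ℂ)
    (hf : ∀ x, f x = c) : ∫ x in confSpace k s, f x = c := by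
  subst hk
  have : confSpace 0 s = Set.univ :=
    Set.eq_univ_of_forall fun x => ⟨Function.injective_of_subsingleton x, fun i => i.elim0⟩
  simp [this, hf, MeasureTheory.Measure.real, MeasureTheory.volume_pi]

/-- The logarithmic form `(2πi)⁻¹ d log (s_a - s_b)` and its conjugate, with the weights of the
propagator at the point `u` of the twistor line. -/
noncomputable def edgeForm (u : ℂ) (s ξ : S → ℂ) (a b : S) : ℂ :=
  1 / (2 * Real.pi * Complex.I) * (u * ((ξ a - ξ b) / (s a - s b)) -
    (1 - u) * starRingEnd ℂ ((ξ a - ξ b) / (s a - s b)))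

/-- Numerator and denominator both change sign. This makes the result independent of the direction
of the edge and of the representative of a cyclic word. -/
theorem edgeForm_symm (u : ℂ) (s ξ : S → ℂ) (a b : S) :
    edgeForm u s ξ a b = edgeForm u s ξ b a := by
  rw [edgeForm, edgeForm, ← neg_sub (ξ b), ← neg_sub (s b), neg_div_neg_eq]

variable [Fintype S]

/-- This is `d log |q|² = 2 Re (dq / q)` for `q = s_a - s_b`, which depends linearly on the marked
points. -/
theorem fderiv_green {k : ℕ} (a b : S) (x : Fin k → ℂ) (s ξ : S → ℂ) (hab : s a ≠ s b) :
    fderiv ℝ (fun y : (Fin k → ℂ) × (S → ℂ) => green (y.2 a) (y.2 b)) (x, s) (0, ξ) =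
      1 / (2 * Real.pi * Complex.I) * (2 * ((ξ a - ξ b) / (s a - s b)).re : ℝ) := by
  let L : (Fin k → ℂ) × (S → ℂ) →L[ℝ] ℂ :=
    (ContinuousLinearMap.proj (R := ℝ) (φ := fun _ : S => ℂ) a -
      ContinuousLinearMap.proj (R := ℝ) (φ := fun _ : S => ℂ) b).comp
      (ContinuousLinearMap.snd ℝ _ _)
  have hL : L (x, s) ≠ 0 := sub_ne_zero.2 hab
  have h := (Complex.ofRealCLM.hasFDerivAt.comp (x, s)
    ((L.hasFDerivAt (x := (x, s))).norm_sq.log (by positivity))).const_mul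
      (1 / (2 * Real.pi * Complex.I))
  rw [HasFDerivAt.fderiv (f := fun y : (Fin k → ℂ) × (S → ℂ) => green (y.2 a) (y.2 b)) h]
  have h1 : L (x, s) = s a - s b := rfl
  have h2 : L (0, ξ) = ξ a - ξ b := rfl
  simp only [_root_.smul_apply, ContinuousLinearMap.comp_apply, innerSL_apply_apply,
    h1, h2, smul_eq_mul, Complex.ofRealCLM_apply, Complex.inner, ← Complex.normSq_eq_norm_sq]
  congr 2
  rw [Complex.div_re, Complex.mul_re, Complex.conj_re, Complex.conj_im, nsmul_eq_mul]
  push_cast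
  ring

/-- With `q = (ξ a - ξ b) / (s a - s b)` the real derivatives along `ξ` and `I • ξ` are proportional
to `2 Re q` and `2 Re (I q) = -2 Im q`, and these recombine to `q`. With the opposite sign they give
the conjugate of `q`. -/
theorem dHol_green {k : ℕ} (a b : S) (x : Fin k → ℂ) (s ξ : S → ℂ) (hab : s a ≠ s b) :
    dHol (fun y : (Fin k → ℂ) × (S → ℂ) => green (y.2 a) (y.2 b)) (x, s) (0, ξ) =
      1 / (2 * Real.pi * Complex.I) * ((ξ a - ξ b) / (s a - s b)) := by
  rw [dHol, Prod.smul_mk, smul_zero, fderiv_green a b x s _ hab, fderiv_green a b x s _ hab,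
    Pi.smul_apply, Pi.smul_apply, ← smul_sub, smul_eq_mul, mul_div_assoc]
  generalize (ξ a - ξ b) / (s a - s b) = q
  rw [Complex.I_mul_re]
  conv_rhs => rw [← Complex.re_add_im q]
  push_cast
  ring

theorem dAnti_green {k : ℕ} (a b : S) (x : Fin k → ℂ) (s ξ : S → ℂ) (hab : s a ≠ s b) :
    dAnti (fun y : (Fin k → ℂ) × (S → ℂ) => green (y.2 a) (y.2 b)) (x, s) (0, ξ) =
      1 / (2 * Real.pi * Complex.I) * starRingEnd ℂ ((ξ a - ξ b) / (s a - s b)) := by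
  rw [dAnti, Prod.smul_mk, smul_zero, fderiv_green a b x s _ hab, fderiv_green a b x s _ hab,
    Pi.smul_apply, Pi.smul_apply, ← smul_sub, smul_eq_mul, mul_div_assoc]
  generalize (ξ a - ξ b) / (s a - s b) = q
  rw [Complex.I_mul_re]
  conv_rhs => rw [← Complex.re_add_im q]
  simp only [map_add, map_mul, Complex.conj_ofReal, Complex.conj_I]
  push_cast
  ring

/-- The fibre is a point and the determinant has size one, so the amplitude is the propagator
itself. This holds for every `u`, since a vector tangent to a slice is not seen by `z dw - w dz`. -/
theorem DGraph.IsFeynman.amplitude_edge [DecidableEq S] {Γ : DGraph S 1} (hΓ : Γ.IsFeynman)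
    {a b : S} (ha : Γ.dec (0, false) = some a) (hb : Γ.dec (0, true) = some b) (u : ℂ) {s : S → ℂ}
    (hs : Function.Injective s) (ξ : Fin 1 → S → ℂ) :
    Γ.amplitude.twistorLine.slice u 1 s ξ = if a = b then 0 else edgeForm u s (ξ 0) a b := by
  have h0 := Γ.numInt_eq_zero hΓ.val_one
  simp only [Form.slice, Form.twistorLine, amplitude]
  split_ifs with h hab hab
  · refine absurd ⟨rfl, a, ?_⟩ h.2.1
    rintro ⟨i, j⟩
    rw [Subsingleton.elim i 0]
    cases j
    · exact ha
    · rw [hb, hab]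
  · refine integral_confSpace_zero h0 _ _ _ fun x => ?_
    have hg : Γ.edgeGreen 0 = fun y => green (y.2 a) (y.2 b) := by
      funext y
      simp [edgeGreen, position, ha, hb]
    -- In the absence of internal vertices the frame starts directly with the lift of the base
    -- vector.
    have hf : Γ.frame (fun i => (ξ i, (-(0 : ℂ), (0 : ℂ)))) 0 = ((0, ξ 0), 0) := by
      simp [frame, h0]
    have hne := hs.ne hab
    simp only [Matrix.det_fin_one, Matrix.of_apply, propagator, hg, Fin.val_zero, hf,
      dHol_green a b x s _ hne, dAnti_green a b x s _ hne, edgeForm]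
    simp
    ring
  · rfl
  · refine absurd ⟨hΓ.2.2.2, ?_, by omega⟩ h
    rintro ⟨-, c, hc⟩
    rw [hc, Option.some_inj] at ha hb
    exact hab (ha.symm.trans hb)

theorem DGraph.IsFeynman.amplitude_eq_zero {Γ : DGraph S e} (hΓ : Γ.IsFeynman) (he : e ≠ 1) {u : ℂ}
    (hu : u = 0 ∨ u = 1) (r : ℕ) (s : S → ℂ) (ξ : Fin r → S → ℂ) :
    Γ.amplitude.twistorLine.slice u r s ξ = 0 :=
  Γ.amplitude_slice_eq_zero (Nat.pos_of_ne_zero fun h0 => he (hΓ.2.2.1.eq_one h0)) hu r s ξ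

/-- The degree of the form is `e - 2 * numInt = 1`. -/
theorem DGraph.IsFeynman.amplitude_edge_of_ne {Γ : DGraph S 1} (hΓ : Γ.IsFeynman)
    (u : ℂ) {r : ℕ} (hr : r ≠ 1) (s : S → ℂ) (ξ : Fin r → S → ℂ) :
    Γ.amplitude.twistorLine.slice u r s ξ = 0 := by
  have h0 := Γ.numInt_eq_zero hΓ.val_one
  simp only [Form.slice, Form.twistorLine, amplitude]
  rw [if_neg]
  omega

end OneEdge
-- The effective action and its pullback along `F` at the ends of the twistor line.
section EffectiveAction

variable {S : Type*} {e : ℕ}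

theorem treeGraph_one_isFeynman (a b : S) : (treeGraph 1 [a, b] .nil).IsFeynman :=
  treeGraph_isFeynman 0 [a, b] .nil rfl rfl

theorem treeGraph_one_isGen {a b : S} (hab : a ≠ b) : (treeGraph 1 [a, b] .nil).IsGen 0 := by
  have h := treeGraph_one_isFeynman a b
  have h0 := numInt_eq_zero _ h.val_one
  refine ⟨h.1, h.2.2.1, ?_, ?_⟩
  · rw [defect, numExt_of_numInt _ h0, h0]; norm_num
  · rintro (h1 | ⟨-, c, hc⟩ | ⟨x, y, hne, hxy, -⟩ | ⟨x, y, hne, -⟩)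
    · exact h.2.2.2 h1
    · have h1 := hc (0, false)
      have h2 := hc (0, true)
      have h1' : some a = some c := h1
      have h2' : some b = some c := h2
      exact hab (Option.some_inj.1 (h1'.trans h2'.symm))
    · exact hne (eq_of_vtx _ (h.val_one x) hxy)
    · exact hne (Subsingleton.elim _ _)

theorem loops_of_numInt (Γ : DGraph S 1) (h0 : Γ.numInt = 0) : Γ.loops = 0 := by
  rw [loops, numExt_of_numInt _ h0, h0]; norm_num

/-- A relabelling of one edge can at most exchange its two ends. -/
theorem dec_relabel_one (Γ : DGraph S 1) (p : Relabel 1) :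
    (Γ.relabel p).dec (0, false) = Γ.dec (0, false) ∧ (Γ.relabel p).dec (0, true) = Γ.dec (0, true) ∨
      (Γ.relabel p).dec (0, false) = Γ.dec (0, true) ∧
        (Γ.relabel p).dec (0, true) = Γ.dec (0, false) := by
  have h : ∀ b, (Γ.relabel p).dec (0, b) = Γ.dec (0, p.2 0 b) := fun b => by
    change Γ.dec (p.1 0, p.2 0 b) = _
    rw [Subsingleton.elim (p.1 0) 0]
  have hp : ∀ σ : Equiv.Perm Bool, σ false = false ∧ σ true = true ∨ σ false = true ∧ σ true = false :=
    by decide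
  rcases hp (p.2 0) with ⟨h1, h2⟩ | ⟨h1, h2⟩ <;> simp [h, h1, h2]

/-- A single edge has no orientation-reversing symmetry, so nothing cancels in the dual functional.
-/
theorem Relabel.sgn_one (p : Relabel 1) : p.sgn = 1 := by
  simp [Relabel.sgn, Subsingleton.elim p.1 1]

theorem isFeynman_of_isGen_relabel {Γ : DGraph S 1} {p : Relabel 1} (h : (Γ.relabel p).IsGen 0) :
    Γ.IsFeynman := by
  have h := (isGen_relabel_iff p).1 h
  refine ⟨h.1, fun x => ?_, h.2.1, fun h' => h.2.2.2 (.inl h')⟩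
  have : Γ.val x ≤ 2 := (Set.ncard_le_card _).trans (by simp)
  rcases h.1.1 x with h1 | h1 <;> omega

/-- Composition with `p` maps the automorphisms of `Γ` bijectively to the isomorphisms onto
`Γ.relabel p`, and all signs are `1`. -/
theorem sum_sgn_relabel_eq_autCard (Γ : DGraph S 1) (p : Relabel 1) :
    (∑ q : Relabel 1, open Classical in if Γ.relabel q = Γ.relabel p then q.sgn else 0) =
      Γ.autCard := by
  classical
  have : Γ.autCard = Nat.card {q : Relabel 1 // Γ.relabel q = Γ.relabel p} := by
    refine Nat.card_congr ⟨fun q => ⟨q.1.comp p, ?_⟩, fun q => ⟨q.1.comp p.inv, ?_⟩, fun q => ?_,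
      fun q => ?_⟩
    · rw [← relabel_relabel, q.2]
    · rw [← relabel_relabel, q.2, relabel_relabel, Relabel.comp_inv, relabel_one]
    · apply Subtype.ext
      ext i <;> simp [Relabel.comp, Relabel.inv]
    · apply Subtype.ext
      ext i <;> simp [Relabel.comp, Relabel.inv]
  rw [this, Nat.card_eq_fintype_card, Fintype.card_subtype, Finset.card_filter]
  push_cast
  exact Finset.sum_congr rfl fun q _ => by rw [Relabel.sgn_one]

theorem autCard_ne_zero (Γ : DGraph S e) : Γ.autCard ≠ 0 := by
  have : Nonempty {p : Relabel e // Γ.relabel p = Γ} := ⟨⟨_, Γ.relabel_one⟩⟩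
  exact Nat.card_pos.ne'

variable [Fintype S]

/-- The effective action uses an arbitrary representative of each isomorphism class, which need not
be the planar tree of the correlator. The symmetry of `edgeForm` shows that the choice is harmless.
-/
theorem amplitude_relabel_one {Γ : DGraph S 1} (hΓ : Γ.IsFeynman) {p : Relabel 1}
    (hp : (Γ.relabel p).IsFeynman) (u : ℂ) {s : S → ℂ} (hs : Function.Injective s) (r : ℕ)
    (ξ : Fin r → S → ℂ) :
    (Γ.relabel p).amplitude.twistorLine.slice u r s ξ = Γ.amplitude.twistorLine.slice u r s ξ := by
  classical
  by_cases hr : r = 1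
  · subst hr
    obtain ⟨a, b, ha, hb⟩ := hΓ.exists_dec
    rcases dec_relabel_one Γ p with ⟨h1, h2⟩ | ⟨h1, h2⟩
    · rw [hΓ.amplitude_edge ha hb u hs, hp.amplitude_edge (h1.trans ha) (h2.trans hb) u hs]
    · rw [hΓ.amplitude_edge ha hb u hs, hp.amplitude_edge (h1.trans hb) (h2.trans ha) u hs,
        edgeForm_symm]
      simp only [eq_comm]
  · rw [hΓ.amplitude_edge_of_ne u hr, hp.amplitude_edge_of_ne u hr]

/-- A graph without internal vertices is a single edge and has first Betti number `0`, so every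
graph in the one-loop sum has an internal vertex. -/
theorem effLoop_slice {u : ℂ} (hu : u = 0 ∨ u = 1) (r : ℕ) (s : S → ℂ) (ξ : Fin r → S → ℂ) :
    (effLoop S).twistorLine.slice u r s ξ = 0 := by
  funext e
  change (∑ᶠ q : Quotient (isoSetoid S e), open Classical in
    if (Quotient.out q).IsFeynman ∧ (Quotient.out q).loops = 1 then
      ((Quotient.out q).amplitude.twistorLine.slice u r s ξ / ((Quotient.out q).autCard : ℂ)) •
        Submodule.Quotient.mk (dualGraph (Quotient.out q))
    else 0 : H0 S e) = 0
  refine finsum_eq_zero_of_forall_eq_zero fun q => ?_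
  split_ifs with h
  · obtain ⟨hF, hl⟩ := h
    rw [amplitude_slice_eq_zero _ _ hu, zero_div, zero_smul]
    refine Nat.pos_of_ne_zero fun h0 => ?_
    obtain rfl := hF.2.2.1.eq_one h0
    rw [loops_of_numInt _ h0] at hl
    exact zero_ne_one hl
  · rfl

theorem effAction_slice {u : ℂ} (hu : u = 0 ∨ u = 1) (r : ℕ) (s : S → ℂ) (ξ : Fin r → S → ℂ) :
    (effAction S).twistorLine.slice u r s ξ =
      Pi.single 0 ((effTree S).twistorLine.slice u r s ξ) := by
  change (Pi.single 0 ((effTree S).twistorLine.slice u r s ξ) +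
    Pi.single 1 ((effLoop S).twistorLine.slice u r s ξ) : ℕ → H0hat S) = _
  rw [effLoop_slice hu, Pi.single_zero]
  exact add_zero (M := ℕ → H0hat S) _

/-- For words of length greater than two both sides vanish. For length two, only the class of the
edge itself pairs nontrivially with the tree, and `|Aut|` cancels. -/
theorem treePairing_effTree (w : List S) (hw : 2 ≤ w.length) {u : ℂ} (hu : u = 0 ∨ u = 1) (r : ℕ)
    {s : S → ℂ} (hs : Function.Injective s) (ξ : Fin r → S → ℂ) :
    treePairing w hw ((effTree S).twistorLine.slice u r s ξ _) =
      ∑ t ∈ BinaryTree.treesOfNumNodesEq (w.length - 2),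
        (treeGraph (2 * (w.length - 2) + 1) w t).amplitude.twistorLine.slice u r s ξ := by
  classical
  have hfin := Fintype.ofFinite (Quotient (isoSetoid S (2 * (w.length - 2) + 1)))
  -- There are finitely many graphs with a given number of edges, so the sum is finite and the
  -- linear pairing passes through it.
  have key : treePairing w hw ((effTree S).twistorLine.slice u r s ξ _) =
      ∑ q : Quotient (isoSetoid S (2 * (w.length - 2) + 1)),
        if (Quotient.out q).IsFeynman ∧ (Quotient.out q).loops = 0 then
          ((Quotient.out q).amplitude.twistorLine.slice u r s ξ / ((Quotient.out q).autCard : ℂ)) *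
            ∑ t ∈ BinaryTree.treesOfNumNodesEq (w.length - 2),
              (dualGraph (Quotient.out q)).1 (treeGraph (2 * (w.length - 2) + 1) w t)
        else 0 := by
    have h1 : (effTree S).twistorLine.slice u r s ξ (2 * (w.length - 2) + 1) =
      ∑ᶠ q : Quotient (isoSetoid S (2 * (w.length - 2) + 1)),
        if (Quotient.out q).IsFeynman ∧ (Quotient.out q).loops = 0 then
          ((Quotient.out q).amplitude.twistorLine.slice u r s ξ / ((Quotient.out q).autCard : ℂ)) •
            (Submodule.Quotient.mk (dualGraph (Quotient.out q)) : H0 S _)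
        else 0 := rfl
    rw [h1, finsum_eq_sum_of_fintype, map_sum]
    refine Finset.sum_congr rfl fun q _ => ?_
    split_ifs
    · rw [map_smul, smul_eq_mul]
      rfl
    · exact map_zero _
  rw [key]
  by_cases hl : w.length = 2
  · obtain ⟨a, b, rfl⟩ := List.length_eq_two.1 hl
    have hT : BinaryTree.treesOfNumNodesEq ([a, b].length - 2) = {.nil} :=
      BinaryTree.treesOfNumNodesEq_zero
    simp only [hT, Finset.sum_singleton]
    let _ : Fintype (Quotient (isoSetoid S 1)) := hfin
    change ∑ q : Quotient (isoSetoid S 1),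
        (if (Quotient.out q).IsFeynman ∧ (Quotient.out q).loops = 0 then
          ((Quotient.out q).amplitude.twistorLine.slice u r s ξ / ((Quotient.out q).autCard : ℂ)) *
              (dualGraph (Quotient.out q)).1 (treeGraph 1 [a, b] .nil)
        else 0) = (treeGraph 1 [a, b] .nil).amplitude.twistorLine.slice u r s ξ
    have hF := treeGraph_one_isFeynman a b
    set Γ := treeGraph 1 [a, b] .nil with hΓ
    -- An edge with equal labels is set to zero in the graph complex and also has amplitude zero by
    -- convention.
    by_cases hab : a = b
    · have hc : Γ.IsConstEdge := by
        refine ⟨rfl, a, ?_⟩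
        rintro ⟨i, j⟩
        rw [Subsingleton.elim i 0]
        cases j
        · rfl
        · rw [hab]; rfl
      have h1 : ¬ Γ.IsGen 0 := fun h => h.2.2.2 (.inr (.inl hc))
      have h2 : Γ.amplitude.twistorLine.slice u r s ξ = 0 := if_neg fun h => h.2.1 hc
      rw [h2]
      refine Finset.sum_eq_zero fun q _ => ?_
      rw [(dualGraph (Quotient.out q)).2.1 Γ h1, mul_zero, ite_self]
    · have hG : Γ.IsGen 0 := treeGraph_one_isGen hab
      have hd : ∀ q : Quotient (isoSetoid S 1), (dualGraph (Quotient.out q)).1 Γ =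
          ∑ p : Relabel 1, if (Quotient.out q).relabel p = Γ then p.sgn else 0 := fun q => if_pos hG
      rw [Finset.sum_eq_single (Quotient.mk (isoSetoid S 1) Γ)]
      · obtain ⟨p, hp⟩ : ∃ p, (Quotient.out (Quotient.mk (isoSetoid S 1) Γ)).relabel p = Γ :=
          Quotient.mk_out (s := isoSetoid S 1) Γ
        rw [hd]
        -- From here on the representative is arbitrary, and the planar tree is one of its
        -- relabellings.
        generalize Quotient.out (Quotient.mk (isoSetoid S 1) Γ) = Γ' at hp ⊢
        rw [← hp] at hG hF ⊢
        have hF' := isFeynman_of_isGen_relabel hG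
        rw [sum_sgn_relabel_eq_autCard, if_pos ⟨hF', loops_of_numInt _ (numInt_eq_zero _ hF'.val_one)⟩,
          amplitude_relabel_one hF' hF u hs, div_mul_cancel₀]
        exact_mod_cast autCard_ne_zero Γ'
      · intro q _ hq
        rw [hd, Finset.sum_eq_zero, mul_zero, ite_self]
        intro p _
        rw [if_neg]
        intro hp
        apply hq
        rw [← Quotient.out_eq q]
        exact Quotient.sound (s := isoSetoid S 1) ⟨p, hp⟩
      · simp
  -- A word of length greater than two gives graphs with more than one edge, on both sides.
  · rw [Finset.sum_eq_zero, Finset.sum_eq_zero]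
    · intro t ht
      exact (treeGraph_isFeynman (w.length - 2) w t (by omega)
        (BinaryTree.mem_treesOfNumNodesEq.1 ht)).amplitude_eq_zero (by omega) hu r s ξ
    · intro q _
      split_ifs with h
      · rw [h.1.amplitude_eq_zero (by omega) hu r s ξ, zero_div, zero_mul]
      · rfl

theorem pullF_effTree_slice {u : ℂ} (hu : u = 0 ∨ u = 1) (r : ℕ)
    {s : S → ℂ} (hs : Function.Injective s) (ξ : Fin r → S → ℂ) :
    pullF ((effTree S).twistorLine.slice u r s ξ) =
      (hodgeCorrelator S).twistorLine.slice u r s ξ := by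
  funext W
  change _ = if 2 ≤ (Quotient.out W).length then
    1 / (cyclicAutCard W : ℂ) *
      ∑ t ∈ BinaryTree.treesOfNumNodesEq ((Quotient.out W).length - 2),
        (treeGraph (2 * ((Quotient.out W).length - 2) + 1)
          (Quotient.out W) t).amplitude.twistorLine.slice u r s ξ
  else 0
  rw [pullF]
  split_ifs with h
  · rw [treePairing_effTree _ h hu r hs]
  · rfl

end EffectiveAction

/-! ### The Hodge correlator class at the ends of the twistor line. -/

section Correlator

variable {S : Type*}

theorem out_length (W : Cycle S) : (Quotient.out W).length = W.length := by
  conv_rhs => rw [← Quotient.out_eq W]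
  rfl

variable [Fintype S]

/-- The trees of a word of length `m > 2` have `2 (m - 2) + 1 > 1` edges and thus an internal
vertex. Shorter words have coefficient `0` by definition. -/
theorem hodgeCorrelator_slice_of_length_ne {W : Cycle S} (hW : W.length ≠ 2) {u : ℂ}
    (hu : u = 0 ∨ u = 1) (r : ℕ) (s : S → ℂ) (ξ : Fin r → S → ℂ) :
    (hodgeCorrelator S).twistorLine.slice u r s ξ W = 0 := by
  rw [← out_length] at hW
  refine ite_eq_right_iff.2 fun h => mul_eq_zero_of_right _ (Finset.sum_eq_zero fun t ht => ?_)
  exact (treeGraph_isFeynman _ _ t (by omega)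
    (BinaryTree.mem_treesOfNumNodesEq.1 ht)).amplitude_eq_zero (by omega) hu r s ξ

theorem hodgeCorrelator_slice_of_ne {r : ℕ} (hr : r ≠ 1) {u : ℂ} (hu : u = 0 ∨ u = 1) (s : S → ℂ)
    (ξ : Fin r → S → ℂ) :
    (hodgeCorrelator S).twistorLine.slice u r s ξ = 0 := by
  funext W
  refine ite_eq_right_iff.2 fun h => mul_eq_zero_of_right _ (Finset.sum_eq_zero fun t ht => ?_)
  have hF := treeGraph_isFeynman _ (Quotient.out W) t (by omega)
    (BinaryTree.mem_treesOfNumNodesEq.1 ht)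
  by_cases hl : (Quotient.out W).length = 2
  · generalize Quotient.out W = w at *
    obtain ⟨a, b, rfl⟩ := List.length_eq_two.1 hl
    exact hF.amplitude_edge_of_ne u hr s ξ
  · exact hF.amplitude_eq_zero (by omega) hu r s ξ

theorem hodgeCorrelator_slice_edge [DecidableEq S] (a b : S) (u : ℂ) {s : S → ℂ}
    (hs : Function.Injective s) (ξ : Fin 1 → S → ℂ) :
    (hodgeCorrelator S).twistorLine.slice u 1 s ξ ([a, b] : List S) =
      if a = b then 0 else edgeForm u s (ξ 0) a b := by
  have hval : ∀ a b : S, (treeGraph 1 [a, b] .nil).amplitude.twistorLine.slice u 1 s ξ =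
      if a = b then 0 else edgeForm u s (ξ 0) a b := fun a b =>
    (treeGraph_one_isFeynman a b).amplitude_edge rfl rfl u hs ξ
  -- The chosen representative of the cyclic word is known only up to rotation.
  obtain ⟨c, d, hcd, hcd'⟩ : ∃ c d, Quotient.out (([a, b] : List S) : Cycle S) = [c, d] ∧
      (c = a ∧ d = b ∨ c = b ∧ d = a) := by
    have h : Quotient.out (([a, b] : List S) : Cycle S) ~r [a, b] :=
      Quotient.mk_out (s := List.IsRotated.setoid S) [a, b]
    obtain ⟨c, d, hcd⟩ := List.length_eq_two.1 (h.perm.length_eq)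
    refine ⟨c, d, hcd, ?_⟩
    rw [hcd] at h
    have := h.perm
    rw [List.cons_perm_iff_perm_erase] at this
    by_cases hca : c = a
    · subst hca
      have := this.2
      simp at this
      exact .inl ⟨rfl, this⟩
    · have hac : a ≠ c := fun h => hca h.symm
      have h1 : c = b := by simpa [hca] using this.1
      subst h1
      have := this.2
      simp [hac] at this
      exact .inr ⟨rfl, this⟩
  have hAut : c ≠ d → cyclicAutCard (([a, b] : List S) : Cycle S) = 1 := by
    intro hne
    rw [cyclicAutCard, hcd, Finset.card_eq_one]
    refine ⟨0, ?_⟩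
    ext i
    simp only [List.length_cons, List.length_nil, Finset.mem_filter, Finset.mem_range,
      Finset.mem_singleton]
    constructor
    · rintro ⟨hi, h⟩
      by_contra h0
      obtain rfl : i = 1 := by omega
      simp [List.rotate_cons_succ] at h
      exact hne h.2
    · rintro rfl
      simp
  have h1 : (hodgeCorrelator S).twistorLine.slice u 1 s ξ ([a, b] : List S) =
      1 / (cyclicAutCard (([a, b] : List S) : Cycle S) : ℂ) *
        (treeGraph 1 [c, d] .nil).amplitude.twistorLine.slice u 1 s ξ := by
    change (if 2 ≤ (Quotient.out (([a, b] : List S) : Cycle S)).length then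
      1 / (cyclicAutCard (([a, b] : List S) : Cycle S) : ℂ) *
        ∑ t ∈ BinaryTree.treesOfNumNodesEq
            ((Quotient.out (([a, b] : List S) : Cycle S)).length - 2),
          (treeGraph (2 * ((Quotient.out (([a, b] : List S) : Cycle S)).length - 2) + 1)
            (Quotient.out (([a, b] : List S) : Cycle S)) t).amplitude.twistorLine.slice u 1 s ξ
      else 0) = _
    rw [hcd, if_pos (by simp)]
    simp
  rw [h1, hval]
  split_ifs with h2 h3 h3
  · simp
  · rcases hcd' with ⟨rfl, rfl⟩ | ⟨rfl, rfl⟩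
    · exact absurd h2 h3
    · exact absurd h2.symm h3
  · rcases hcd' with ⟨rfl, rfl⟩ | ⟨rfl, rfl⟩
    · exact absurd h3 h2
    · exact absurd h3.symm h2
  · rw [hAut h2]
    rcases hcd' with ⟨rfl, rfl⟩ | ⟨rfl, rfl⟩
    · simp
    · simp [edgeForm_symm u s (ξ 0) c d]

end Correlator
-- Special derivations given by quadratic cyclic words.
/-- A derivation of the free algebra is determined by its values on the generators. -/
theorem derivationOf_eq_rightAd (D : Fin 2 → Alg) (X : Alg)
    (hD : ∀ i, D i = ⁅FreeAlgebra.ι ℂ i, X⁆) : derivationOf D = rightAd X := by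
  -- For upper triangular matrices with equal diagonal entries, multiplicativity is the Leibniz rule
  -- in the corner, which the bracket with `X` satisfies.
  have h : ∀ x : Alg, FreeAlgebra.lift ℂ (fun i : Fin 2 =>
      (!![FreeAlgebra.ι ℂ i, D i; 0, FreeAlgebra.ι ℂ i] : Matrix (Fin 2) (Fin 2) Alg)) x =
        !![x, ⁅x, X⁆; 0, x] := by
    intro x
    induction x using FreeAlgebra.induction with
    | grade0 r =>
      rw [AlgHom.commutes]
      have : ⁅algebraMap ℂ Alg r, X⁆ = 0 := by
        rw [Ring.lie_def, Algebra.commutes, sub_self]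
      rw [this]
      ext i j
      fin_cases i <;> fin_cases j <;> simp [Matrix.algebraMap_matrix_apply]
    | grade1 i => simp [hD]
    | mul a b ha hb =>
      rw [map_mul, ha, hb, Matrix.mul_fin_two]
      have : a * ⁅b, X⁆ + ⁅a, X⁆ * b = ⁅a * b, X⁆ := by
        simp only [Ring.lie_def]; noncomm_ring
      simp [this]
    | add a b ha hb =>
      rw [map_add, ha, hb]
      have : ⁅a, X⁆ + ⁅b, X⁆ = ⁅a + b, X⁆ := by
        simp only [Ring.lie_def]; noncomm_ring
      simp [this]
  ext x
  simp [derivationOf, h, rightAd]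

theorem length_of_mem_cyclicWords {m : ℕ} {W : Cycle (Fin 3)} (hW : W ∈ cyclicWords m) :
    W.length = m := by
  obtain ⟨x, -, rfl⟩ := Finset.mem_image.1 hW
  simp

theorem cyclicWords_two : cyclicWords 2 =
    {(↑([0, 0] : List (Fin 3)) : Cycle (Fin 3)), (↑([0, 1] : List (Fin 3)) : Cycle (Fin 3)),
      (↑([0, 2] : List (Fin 3)) : Cycle (Fin 3)), (↑([1, 1] : List (Fin 3)) : Cycle (Fin 3)),
      (↑([1, 2] : List (Fin 3)) : Cycle (Fin 3)), (↑([2, 2] : List (Fin 3)) : Cycle (Fin 3))} := by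
  rw [show cyclicWords 2 = Finset.univ.image fun x : Fin 2 → Fin 3 =>
    (List.ofFn x : Cycle (Fin 3)) by rw [cyclicWords]]
  decide

theorem specialDer_eq_zero (c : Cycle (Fin 3) → ℂ) (m : ℕ)
    (hc : ∀ W : Cycle (Fin 3), W.length = m → c W = 0) : specialDer c m = 0 := by
  have h : ∀ s, cyclicDeriv c m s = 0 := fun s => Finset.sum_eq_zero fun W hW => by
    rw [hc W (length_of_mem_cyclicWords hW), zero_smul]
  rw [specialDer, derivationOf_eq_rightAd _ 0 fun i => by rw [h]]
  ext Y
  simp [rightAd, Ring.lie_def]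

/-- The cyclic derivatives are `k01 X₁ + k02 X_∞` and `k01 X₀ + k12 X_∞`. Substituting `X_∞ = -X₀ -
X₁` and bracketing gives `(k01 - k02) [X₀, X₁]` and `(k01 - k12) [X₁, X₀]`, and both are brackets
with the same element. -/
theorem specialDer_two (c : Cycle (Fin 3) → ℂ) (k : Fin 3 → Fin 3 → ℂ)
    (hc : ∀ a b : Fin 3, c ([a, b] : List (Fin 3)) = if a = b then 0 else k a b) :
    specialDer c 2 = rightAd ((k 0 1 - k 1 2) • FreeAlgebra.ι ℂ (0 : Fin 2) +
      (k 0 1 - k 0 2) • FreeAlgebra.ι ℂ (1 : Fin 2)) := by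
  have hsum : ∀ F : Cycle (Fin 3) → Alg, ∑ W ∈ cyclicWords 2, F W =
      F ([0, 0] : List (Fin 3)) + (F ([0, 1] : List (Fin 3)) + (F ([0, 2] : List (Fin 3)) +
        (F ([1, 1] : List (Fin 3)) + (F ([1, 2] : List (Fin 3)) + F ([2, 2] : List (Fin 3)))))) := by
    intro F
    rw [cyclicWords_two, Finset.sum_insert (by decide), Finset.sum_insert (by decide),
      Finset.sum_insert (by decide), Finset.sum_insert (by decide), Finset.sum_insert (by decide),
      Finset.sum_singleton]
  have hlists : ∀ a b s : Fin 3, ((Cycle.lists (([a, b] : List (Fin 3)) : Cycle (Fin 3))).map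
      (dropLetter s)).sum = dropLetter s [a, b] + dropLetter s [b, a] := by
    intro a b s
    rw [Cycle.lists_coe]
    simp [List.cyclicPermutations_cons]
  refine derivationOf_eq_rightAd _ _ fun i => ?_
  rw [cyclicDeriv, hsum]
  simp only [hlists, hc]
  fin_cases i
  · simp [dropLetter, letter, Ring.lie_def, mul_add, add_mul, sub_smul, smul_sub, mul_sub, sub_mul]
    abel
  · simp [dropLetter, letter, Ring.lie_def, mul_add, add_mul, sub_smul, smul_sub, mul_sub, sub_mul]
    abel

/-! ### The coordinates `(z, v)` on the moduli space of four points. -/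

theorem crossRatioMap_eq {p : ℂ × ℂ} (h0 : p.1 ≠ 0) (h1 : p.1 ≠ 1) :
    crossRatioMap p = ![0, p.2 / (p.1 * (1 - p.1)), p.2 / p.1] := by
  have h1' : 1 - p.1 ≠ 0 := sub_ne_zero.2 h1.symm
  ext i
  fin_cases i
  · simp [crossRatioMap, normalize, div_neg]
  · simp [crossRatioMap, normalize]
    field_simp
    ring
  · simp [crossRatioMap]

theorem crossRatioMap_injective {p : ℂ × ℂ} (h0 : p.1 ≠ 0) (h1 : p.1 ≠ 1) (h2 : p.2 ≠ 0) :
    Function.Injective (crossRatioMap p) := by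
  have h1' : 1 - p.1 ≠ 0 := sub_ne_zero.2 h1.symm
  have ha : p.2 / (p.1 * (1 - p.1)) ≠ 0 := by positivity
  have hb : p.2 / p.1 ≠ 0 := by positivity
  have hab : p.2 / (p.1 * (1 - p.1)) ≠ p.2 / p.1 := by
    intro h
    field_simp at h
    apply h0
    linear_combination h
  rw [crossRatioMap_eq h0 h1]
  intro i j hij
  fin_cases i <;> fin_cases j <;> simp_all [eq_comm]

theorem crossRatioMap_bijOn :
    Set.BijOn crossRatioMap {p : ℂ × ℂ | p.1 ≠ 0 ∧ p.1 ≠ 1 ∧ p.2 ≠ 0} (moduli 4) := by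
  refine ⟨?_, ?_, ?_⟩
  · rintro p ⟨h0, h1, h2⟩
    refine ⟨crossRatioMap_injective h0 h1 h2, fun i hi => ?_⟩
    obtain rfl : i = 0 := Fin.ext hi
    rw [crossRatioMap_eq h0 h1]
    rfl
  · rintro p ⟨h0, h1, h2⟩ q ⟨k0, k1, k2⟩ h
    have h1' : 1 - p.1 ≠ 0 := sub_ne_zero.2 h1.symm
    have k1' : 1 - q.1 ≠ 0 := sub_ne_zero.2 k1.symm
    rw [crossRatioMap_eq h0 h1, crossRatioMap_eq k0 k1] at h
    have e1 : p.2 / (p.1 * (1 - p.1)) = q.2 / (q.1 * (1 - q.1)) := congrFun h 1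
    have e2 : p.2 / p.1 = q.2 / q.1 := congrFun h 2
    rw [← div_div, ← div_div, e2] at e1
    have hq : q.2 / q.1 ≠ 0 := by positivity
    have e3 : p.1 = q.1 := by
      field_simp at e1
      linear_combination e1
    refine Prod.ext e3 ?_
    rw [e3] at e2
    field_simp at e2
    exact e2
  · rintro s ⟨hs, hs0⟩
    have z0 : s 0 = 0 := hs0 0 rfl
    have n1 : s 1 ≠ 0 := fun h => by
      have := hs (h.trans z0.symm); simp at this
    have n2 : s 2 ≠ 0 := fun h => by
      have := hs (h.trans z0.symm); simp at this
    have n12 : s 1 - s 2 ≠ 0 := fun h => by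
      have := hs (sub_eq_zero.1 h); simp at this
    have hz : 1 - s 2 / s 1 = (s 1 - s 2) / s 1 := by field_simp
    have hz0 : 1 - s 2 / s 1 ≠ 0 := by rw [hz]; positivity
    have hz1 : 1 - s 2 / s 1 ≠ 1 := by
      intro h
      have : s 2 / s 1 ≠ 0 := by positivity
      exact this (by linear_combination -h)
    -- The ratio `s 2 / s 1` is `1 - z`, and then `v = z * s 2`.
    refine ⟨(1 - s 2 / s 1, (1 - s 2 / s 1) * s 2), ⟨hz0, hz1, mul_ne_zero hz0 n2⟩, ?_⟩
    rw [crossRatioMap_eq hz0 hz1]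
    funext i
    fin_cases i
    · exact z0.symm
    · change (1 - s 2 / s 1) * s 2 / ((1 - s 2 / s 1) * (1 - (1 - s 2 / s 1))) = s 1
      rw [mul_div_mul_left _ _ hz0]
      rw [sub_sub_cancel, div_div_cancel₀ n2]
    · change (1 - s 2 / s 1) * s 2 / (1 - s 2 / s 1) = s 2
      field_simp

theorem fderiv_crossRatioMap {p : ℂ × ℂ} (h0 : p.1 ≠ 0) (h1 : p.1 ≠ 1) (η : ℂ × ℂ) :
    fderiv ℂ crossRatioMap p η = ![0,
      η.2 / (p.1 * (1 - p.1)) - p.2 * (1 - 2 * p.1) * η.1 / (p.1 * (1 - p.1)) ^ 2,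
      η.2 / p.1 - p.2 * η.1 / p.1 ^ 2] := by
  have h1' : 1 - p.1 ≠ 0 := sub_ne_zero.2 h1.symm
  have hd : DifferentiableAt ℂ crossRatioMap p := by
    rw [differentiableAt_pi]
    intro i
    fin_cases i
    · change DifferentiableAt ℂ (fun x : ℂ × ℂ => x.2 / (0 - x.1) + x.2 / x.1) p
      fun_prop (disch := simpa)
    · change DifferentiableAt ℂ (fun x : ℂ × ℂ => x.2 / (1 - x.1) + x.2 / x.1) p
      fun_prop (disch := assumption)
    · change DifferentiableAt ℂ (fun x : ℂ × ℂ => x.2 / x.1) p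
      fun_prop (disch := assumption)
  -- The derivative is computed along the line `t ↦ p + t η`, where the quotient rule in one
  -- variable applies to each coordinate.
  have hz : HasDerivAt (fun t : ℂ => p.1 + t * η.1) η.1 0 := by
    simpa using ((hasDerivAt_id (0 : ℂ)).mul_const η.1).const_add p.1
  have hv : HasDerivAt (fun t : ℂ => p.2 + t * η.2) η.2 0 := by
    simpa using ((hasDerivAt_id (0 : ℂ)).mul_const η.2).const_add p.2
  have hp : HasDerivAt (fun t : ℂ => (p.1 + t * η.1, p.2 + t * η.2)) η 0 := hz.prodMk hv
  have hc : HasDerivAt (fun t : ℂ => crossRatioMap (p.1 + t * η.1, p.2 + t * η.2))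
      (fderiv ℂ crossRatioMap p η) 0 :=
    HasFDerivAt.comp_hasDerivAt_of_eq (0 : ℂ) hd.hasFDerivAt hp (by simp)
  refine hc.unique (hasDerivAt_pi.2 fun i => ?_)
  have hvz : HasDerivAt (fun t : ℂ => (p.2 + t * η.2) / (p.1 + t * η.1))
      (η.2 / p.1 - p.2 * η.1 / p.1 ^ 2) 0 := by
    refine (hv.fun_div hz (by simpa using h0)).congr_deriv ?_
    simp only [zero_mul, add_zero]
    field_simp
  have hvx : ∀ x : ℂ, x - p.1 ≠ 0 → HasDerivAt (fun t : ℂ => (p.2 + t * η.2) / (x - (p.1 + t * η.1)))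
      (η.2 / (x - p.1) + p.2 * η.1 / (x - p.1) ^ 2) 0 := by
    intro x hx
    refine (hv.fun_div (hz.const_sub x) (by simpa using hx)).congr_deriv ?_
    simp only [zero_mul, add_zero]
    field_simp
    ring
  fin_cases i
  · refine ((hvx 0 (by simpa using h0)).fun_add hvz).congr_deriv ?_
    change _ = (0 : ℂ)
    rw [zero_sub, div_neg, neg_sq]
    ring
  · refine ((hvx 1 h1').fun_add hvz).congr_deriv ?_
    change _ = η.2 / (p.1 * (1 - p.1)) - p.2 * (1 - 2 * p.1) * η.1 / (p.1 * (1 - p.1)) ^ 2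
    field_simp
    ring
  · exact hvz

/-! ### Comparison with the KZ connection. -/

/-- Both ends of the twistor line are treated at once: the weights `u` and `1 - u` select the KZ
form or its conjugate. Everything is concentrated in form degree one and word length two. -/
theorem specialDer_hodgeCorrelator {u : ℂ} (hu : u = 0 ∨ u = 1) {p : ℂ × ℂ} (h0 : p.1 ≠ 0)
    (h1 : p.1 ≠ 1) (h2 : p.2 ≠ 0) (r : ℕ) (η : Fin r → ℂ × ℂ) :
    specialDer (((hodgeCorrelator (Fin 3)).twistorLine.slice u).pullback crossRatioMap r p η) =
      Form.ofDegreeOne (fun p η => Pi.single 2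
        (-rightAd (u • kzForm p.1 η.1 + (1 - u) • kzFormConj p.1 η.1))) r p η := by
  have hs := crossRatioMap_injective h0 h1 h2
  rw [Form.pullback, Form.ofDegreeOne]
  split_ifs with hr
  · subst hr
    funext m
    by_cases hm : m = 2
    · subst hm
      rw [Pi.single_eq_same, specialDer_two _ _ fun a b => hodgeCorrelator_slice_edge a b u hs _]
      have hneg : ∀ X, -rightAd X = rightAd (-X) := fun X => by
        ext Y
        simp [rightAd, Ring.lie_def]
        abel
      have h1' : 1 - p.1 ≠ 0 := sub_ne_zero.2 h1.symm
      have hz1 : p.1 - 1 ≠ 0 := sub_ne_zero.2 h1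
      rw [hneg]
      set ξ := fderiv ℂ crossRatioMap p (η 0) with hξ
      rw [fderiv_crossRatioMap h0 h1] at hξ
      have hs' := crossRatioMap_eq h0 h1
      set s := crossRatioMap p
      -- The quotient of `v / (z (1 - z))` by `v / (1 - z)` is `1 / z`, so `d log v` cancels. In
      -- `e1` the quotient of `v / (z (1 - z))` by `v / z` is `1 / (1 - z)`.
      have e0 : (ξ 0 - ξ 1) / (s 0 - s 1) - (ξ 1 - ξ 2) / (s 1 - s 2) = -((η 0).1 / p.1) := by
        rw [hξ, hs']
        simp only [Matrix.cons_val, zero_sub, neg_div_neg_eq]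
        have : p.2 / (p.1 * (1 - p.1)) - p.2 / p.1 = p.2 / (1 - p.1) := by
          field_simp; ring
        rw [this]
        field_simp
        ring
      have e1 : (ξ 0 - ξ 1) / (s 0 - s 1) - (ξ 0 - ξ 2) / (s 0 - s 2) =
          -((η 0).1 / (p.1 - 1)) := by
        rw [hξ, hs']
        simp only [Matrix.cons_val, zero_sub, neg_div_neg_eq]
        rw [← neg_sub 1 p.1]
        field_simp
        ring
      -- The prefactor is imaginary. Its sign under conjugation absorbs the minus sign in front of
      -- `∂̄ G`.
      have hpi : starRingEnd ℂ (1 / (2 * Real.pi * Complex.I)) = -(1 / (2 * Real.pi * Complex.I)) := by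
        rw [map_div₀, map_one, map_mul, map_mul, Complex.conj_I, Complex.conj_ofReal,
          map_ofNat, mul_neg, div_neg]
      -- The weights make the expression only real linear in `q`, so the relation is used together
      -- with its conjugate.
      have key : ∀ q q' w : ℂ, q - q' = -w → 1 / (2 * Real.pi * Complex.I) *
          (u * q - (1 - u) * starRingEnd ℂ q) - 1 / (2 * Real.pi * Complex.I) *
          (u * q' - (1 - u) * starRingEnd ℂ q') = -(1 / (2 * Real.pi * Complex.I) *
            (u * w - (1 - u) * starRingEnd ℂ w)) := by
        intro q q' w h
        have h' := congrArg (starRingEnd ℂ) h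
        rw [map_sub, map_neg] at h'
        linear_combination 1 / (2 * Real.pi * Complex.I) * (u * h - (1 - u) * h')
      change rightAd ((edgeForm u s ξ 0 1 - edgeForm u s ξ 1 2) • FreeAlgebra.ι ℂ (0 : Fin 2) +
        (edgeForm u s ξ 0 1 - edgeForm u s ξ 0 2) • FreeAlgebra.ι ℂ (1 : Fin 2)) =
          rightAd (-(u • kzForm p.1 (η 0).1 + (1 - u) • kzFormConj p.1 (η 0).1))
      rw [edgeForm, edgeForm, edgeForm, key _ _ _ e0, key _ _ _ e1, kzForm, kzFormConj, hpi]
      congr 1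
      module
    · rw [Pi.single_eq_of_ne hm]
      exact specialDer_eq_zero _ _ fun W hW =>
        hodgeCorrelator_slice_of_length_ne (by rw [hW]; exact hm) hu _ _ _
  · rw [hodgeCorrelator_slice_of_ne hr hu]
    funext m
    exact specialDer_eq_zero _ _ fun _ _ => rfl

end HodgeCorr

/-! ### The proposition. -/

theorem mainTheorem5 :
    (∀ n : ℕ, 2 ≤ n → ∀ u : ℂ, u = 0 ∨ u = 1 → ∀ s ∈ moduli n,
      ∀ (r : ℕ) (ξ : Fin r → Fin (n - 1) → ℂ), (∀ i, ξ i ∈ moduliTangent n) →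
        (effLoop (Fin (n - 1))).twistorLine.slice u r s ξ = 0 ∧
        (effAction (Fin (n - 1))).twistorLine.slice u r s ξ =
          Pi.single 0 ((effTree (Fin (n - 1))).twistorLine.slice u r s ξ) ∧
        pullF ((effTree (Fin (n - 1))).twistorLine.slice u r s ξ) =
          (hodgeCorrelator (Fin (n - 1))).twistorLine.slice u r s ξ) ∧
    Set.BijOn crossRatioMap {p : ℂ × ℂ | p.1 ≠ 0 ∧ p.1 ≠ 1 ∧ p.2 ≠ 0} (moduli 4) ∧
    (∀ p : ℂ × ℂ, p.1 ≠ 0 → p.1 ≠ 1 → p.2 ≠ 0 → ∀ (r : ℕ) (η : Fin r → ℂ × ℂ),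
      (((effAction (Fin 3)).twistorLine.slice 1).pullback crossRatioMap r p η =
          Pi.single 0 (((effTree (Fin 3)).twistorLine.slice 1).pullback crossRatioMap r p η) ∧
        pullF (((effTree (Fin 3)).twistorLine.slice 1).pullback crossRatioMap r p η) =
          ((hodgeCorrelator (Fin 3)).twistorLine.slice 1).pullback crossRatioMap r p η ∧
        specialDer (((hodgeCorrelator (Fin 3)).twistorLine.slice 1).pullback crossRatioMap r p η) =
          Form.ofDegreeOne (fun p η => Pi.single 2 (-rightAd (kzForm p.1 η.1))) r p η) ∧
      (((effAction (Fin 3)).twistorLine.slice 0).pullback crossRatioMap r p η =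
          Pi.single 0 (((effTree (Fin 3)).twistorLine.slice 0).pullback crossRatioMap r p η) ∧
        pullF (((effTree (Fin 3)).twistorLine.slice 0).pullback crossRatioMap r p η) =
          ((hodgeCorrelator (Fin 3)).twistorLine.slice 0).pullback crossRatioMap r p η ∧
        specialDer (((hodgeCorrelator (Fin 3)).twistorLine.slice 0).pullback crossRatioMap r p η) =
          Form.ofDegreeOne (fun p η => Pi.single 2 (-rightAd (kzFormConj p.1 η.1))) r p η)) := by
  refine ⟨fun n _ u hu s hs r ξ _ => ⟨effLoop_slice hu r s ξ, effAction_slice hu r s ξ,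
    pullF_effTree_slice hu r hs.1 ξ⟩, crossRatioMap_bijOn, fun p h0 h1 h2 r η => ?_⟩
  have hs := crossRatioMap_injective h0 h1 h2
  -- The pullback evaluates the slice forms at `crossRatioMap p` on the image vectors, so the
  -- statements for general forms apply verbatim.
  refine ⟨⟨effAction_slice (.inr rfl) r _ _, pullF_effTree_slice (.inr rfl) r hs _, ?_⟩,
    effAction_slice (.inl rfl) r _ _, pullF_effTree_slice (.inl rfl) r hs _, ?_⟩
  · rw [specialDer_hodgeCorrelator (.inr rfl) h0 h1 h2]
    simp only [one_smul, sub_self, zero_smul, add_zero]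
  · rw [specialDer_hodgeCorrelator (.inl rfl) h0 h1 h2]
    simp only [one_smul, sub_zero, zero_smul, zero_add]
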